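/- Let $(M,\langle\cdot,\cdot\rangle,\tilde\nabla)$ be an oriented smooth Riemann–Cartan $3$-manifold, that is, an oriented Riemannian $3$-manifold with a smooth metric-compatible connection $\tilde\nabla$ on its tangent bundle, possibly with torsion $\tilde T(X,Y)=\tilde\nabla_XY-\tilde\nabla_YX-[X,Y]$, and let $\tilde R(X,Y)Z=\tilde\nabla_X\tilde\nabla_YZ-\tilde\nabla_Y\tilde\nabla_XZ-\tilde\nabla_{[X,Y]}Z$ be its curvature. Let $S$ be a smooth surface embedded in $M$, oriented by a smooth unit normal vector field $N$ along $S$: a frame $(E_1,E_2)$ of $S$ is oriented iff $(N,E_1,E_2)$ is oriented in $M$. For tangent vector fields $X,Y$ of $S$, let - $\nabla_XY$ be the component of $\tilde\nabla_XY$ tangent to $S$, and $T$ the torsion of the connection $\nabla$ on $S$; - $\mathrm{II}(X,Y)=\langle N,\tilde\nabla_XY\rangle$ be the second fundamental form, $W$ the Weingarten map, defined by $\langle WX,Y\rangle=\mathrm{II}(X,Y)$, $\mathrm{III}(X,Y)=\langle WX,WY\rangle$ the third fundamental form, and $H=\operatorname{tr}W$ the mean curvature; - $\tau(X,Y)=\langle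 N,\tilde T(X,Y)\rangle$, a $2$-form on $S$, and ${\star}\tau$ its Hodge dual, the function with $\tau=({\star}\tau)\,dA$ for the area form $dA$ of the oriented surface $S$; - $\boldsymbol H=H+i\,{\star}\tau\colon S\to\mathbb C$; - $JX=N\times X$ be the almost complex structure of $S$; it makes $S$ a Riemann surface, whose local complex charts $z=x+iy$ are the smooth charts with $dz\circ J=i\,dz$. Let $\partial_z=\frac12(\partial_x-i\,\partial_y)$, extend $\mathrm{II}$ and $\mathrm{III}$ complex bilinearly, and let $$\varphi=\mathrm{II}(\partial_z,\partial_z)\,dz^2,\qquad \psi=\mathrm{III}(\partial_z,\partial_z)\,dz^2 .$$ Suppose that the tensor $$L(X,Y)=\tilde R(X,Y)N-J\,W\,J\,T(X,Y)$$ vanishes everywhere on $S$. Then the following two hold. (a) $\boldsymbol H$ is a holomorphic function on $S$ if and only if $\varphi$ is a holomorphic quadratic differential on $S$. (b) If $\boldsymbol H$ is a holomorphic function on $S$, then $\psi$ is a holomorphic quadratic differential on $S$. -/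

import Mathlib

open Bundle Manifold Topology Set
open scoped ContDiff TensorProduct

noncomputable section

namespace RiemannCartan

section Along

variable {M : Type*} [TopologicalSpace M] [ChartedSpace (EuclideanSpace ℝ (Fin 3)) M]
  [IsManifold (𝓡 3) ∞ M]
  {S : Type*} [TopologicalSpace S] [ChartedSpace (EuclideanSpace ℝ (Fin 2)) S]

/-- The components of a vector field `V` along `f : S → M` in the standard local frame of the tangent
bundle of `M` near `f p`. -/
def coordAlong (f : S → M) (p : S) (V : ∀ q : S, TangentSpace (𝓡 3) (f q)) (q : S) :
    EuclideanSpace ℝ (Fin 3) :=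
  (trivializationAt (EuclideanSpace ℝ (Fin 3)) (TangentSpace (𝓡 3) : M → Type _) (f p)
    (TotalSpace.mk' (EuclideanSpace ℝ (Fin 3)) (f q) (V q))).2

/-- The covariant derivative `u ↦ ∇_u V` at `p` of a vector field `V` along `f : S → M`, for a
connection of the tangent bundle of `M`: if `V = ∑ Vⁱ Eᵢ` in a local frame, it is
`∑ dVⁱ(u) Eᵢ + ∑ Vⁱ ∇_(df u) Eᵢ`. See `covAlong_comp`: if `V` is the restriction of a vector field `Y`
on `M`, it is `∇_(df u) Y`. -/
def covAlong (cov : CovariantDerivative (𝓡 3) (EuclideanSpace ℝ (Fin 3))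
      (TangentSpace (𝓡 3) : M → Type _))
    (f : S → M) (V : ∀ q : S, TangentSpace (𝓡 3) (f q)) (p : S) :
    TangentSpace (𝓡 2) p →L[ℝ] TangentSpace (𝓡 3) (f p) :=
  (trivializationAt (EuclideanSpace ℝ (Fin 3)) (TangentSpace (𝓡 3) : M → Type _) (f p)).symmL ℝ
      (f p) ∘L mvfderiv (𝓡 2) (coordAlong f p V) p
    + cov (FiberBundle.extend (EuclideanSpace ℝ (Fin 3)) (V p)) (f p) ∘L mfderiv (𝓡 2) (𝓡 3) f p

/-- Differentiability at `p` of a vector field along `f : S → M`. -/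
abbrev DiffAlongAt (f : S → M) (V : ∀ q : S, TangentSpace (𝓡 3) (f q)) (p : S) : Prop :=
  MDifferentiableAt (𝓡 2) (𝓡 3).tangent
    (fun q ↦ TotalSpace.mk' (EuclideanSpace ℝ (Fin 3)) (f q) (V q)) p

variable (cov : CovariantDerivative (𝓡 3) (EuclideanSpace ℝ (Fin 3))
      (TangentSpace (𝓡 3) : M → Type _)) {f : S → M} {p : S}
   {V V' : ∀ q : S, TangentSpace (𝓡 3) (f q)}

lemma DiffAlongAt.coord (h : DiffAlongAt f V p) :
    MDifferentiableAt (𝓡 2) 𝓘(ℝ, EuclideanSpace ℝ (Fin 3)) (coordAlong f p V) p :=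
  ((mdifferentiableAt_totalSpace (𝓡 3) _).1 h).2

lemma DiffAlongAt.base (h : DiffAlongAt f V p) : MDifferentiableAt (𝓡 2) (𝓡 3) f p :=
  ((mdifferentiableAt_totalSpace (𝓡 3) _).1 h).1

lemma eventually_mem_baseSet (h : ContinuousAt f p) : ∀ᶠ q in 𝓝 p, f q ∈
    (trivializationAt (EuclideanSpace ℝ (Fin 3)) (TangentSpace (𝓡 3) : M → Type _) (f p)).baseSet :=
  h.preimage_mem_nhds ((trivializationAt _ _ (f p)).open_baseSet.mem_nhds
    (FiberBundle.mem_baseSet_trivializationAt' (f p)))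

lemma triv_add (x y : M) (hy : y ∈ (trivializationAt (EuclideanSpace ℝ (Fin 3))
      (TangentSpace (𝓡 3) : M → Type _) x).baseSet) (v w : TangentSpace (𝓡 3) y) :
    (trivializationAt (EuclideanSpace ℝ (Fin 3)) (TangentSpace (𝓡 3) : M → Type _) x
      (TotalSpace.mk' (EuclideanSpace ℝ (Fin 3)) y (v + w))).2 =
    (trivializationAt (EuclideanSpace ℝ (Fin 3)) (TangentSpace (𝓡 3) : M → Type _) x
      (TotalSpace.mk' (EuclideanSpace ℝ (Fin 3)) y v)).2 +
    (trivializationAt (EuclideanSpace ℝ (Fin 3)) (TangentSpace (𝓡 3) : M → Type _) x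
      (TotalSpace.mk' (EuclideanSpace ℝ (Fin 3)) y w)).2 :=
  ((trivializationAt (EuclideanSpace ℝ (Fin 3))
      (TangentSpace (𝓡 3) : M → Type _) x).linear ℝ hy).map_add v w

lemma triv_smul (x y : M) (hy : y ∈ (trivializationAt (EuclideanSpace ℝ (Fin 3))
      (TangentSpace (𝓡 3) : M → Type _) x).baseSet) (c : ℝ) (v : TangentSpace (𝓡 3) y) :
    (trivializationAt (EuclideanSpace ℝ (Fin 3)) (TangentSpace (𝓡 3) : M → Type _) x
      (TotalSpace.mk' (EuclideanSpace ℝ (Fin 3)) y (c • v))).2 =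
    c • (trivializationAt (EuclideanSpace ℝ (Fin 3)) (TangentSpace (𝓡 3) : M → Type _) x
      (TotalSpace.mk' (EuclideanSpace ℝ (Fin 3)) y v)).2  :=
  ((trivializationAt (EuclideanSpace ℝ (Fin 3))
      (TangentSpace (𝓡 3) : M → Type _) x).linear ℝ hy).map_smul c v

lemma cov_extend_add {x : M} (v w : TangentSpace (𝓡 3) x) :
    cov (FiberBundle.extend (EuclideanSpace ℝ (Fin 3)) (v + w)) x =
    cov (FiberBundle.extend (EuclideanSpace ℝ (Fin 3)) v) x +
      cov (FiberBundle.extend (EuclideanSpace ℝ (Fin 3)) w) x := by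
  rw [← cov.isCovariantDerivativeOnUniv.add
    (FiberBundle.mdifferentiableAt_extend ..) (FiberBundle.mdifferentiableAt_extend ..)]
  refine cov.isCovariantDerivativeOnUniv.congr_of_eventuallyEq
    (FiberBundle.mdifferentiableAt_extend ..) (mdifferentiableAt_add_section
      (FiberBundle.mdifferentiableAt_extend ..) (FiberBundle.mdifferentiableAt_extend ..))
    Filter.univ_mem ?_
  filter_upwards [(trivializationAt (EuclideanSpace ℝ (Fin 3)) (TangentSpace (𝓡 3) : M → Type _)
    x).open_baseSet.mem_nhds (FiberBundle.mem_baseSet_trivializationAt' x)] with y hy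
  have h := triv_add x x (FiberBundle.mem_baseSet_trivializationAt' x) v w
  simp only [FiberBundle.extend, Pi.add_apply, TotalSpace.mk'] at h ⊢
  rw [h, ← Trivialization.coe_symmₗ (R := ℝ) _ hy, map_add]

lemma cov_extend_smul {x : M} (c : ℝ) (v : TangentSpace (𝓡 3) x) :
    cov (FiberBundle.extend (EuclideanSpace ℝ (Fin 3)) (c • v)) x =
    c • cov (FiberBundle.extend (EuclideanSpace ℝ (Fin 3)) v) x := by
  rw [← cov.isCovariantDerivativeOnUniv.smul_const c (FiberBundle.mdifferentiableAt_extend ..)]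
  refine cov.isCovariantDerivativeOnUniv.congr_of_eventuallyEq
    (FiberBundle.mdifferentiableAt_extend ..) (mdifferentiableAt_const.smul_section
      (FiberBundle.mdifferentiableAt_extend ..))
    Filter.univ_mem ?_
  filter_upwards [(trivializationAt (EuclideanSpace ℝ (Fin 3)) (TangentSpace (𝓡 3) : M → Type _)
    x).open_baseSet.mem_nhds (FiberBundle.mem_baseSet_trivializationAt' x)] with y hy
  have h := triv_smul x x (FiberBundle.mem_baseSet_trivializationAt' x) c v
  simp only [FiberBundle.extend, Pi.smul_apply, TotalSpace.mk'] at h ⊢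
  rw [h, ← Trivialization.coe_symmₗ (R := ℝ) _ hy, map_smul]

lemma symmL_coordAlong (v : TangentSpace (𝓡 3) (f p)) :
    (trivializationAt (EuclideanSpace ℝ (Fin 3)) (TangentSpace (𝓡 3) : M → Type _) (f p)).symmL ℝ
      (f p) (trivializationAt (EuclideanSpace ℝ (Fin 3)) (TangentSpace (𝓡 3) : M → Type _) (f p)
        (TotalSpace.mk' (EuclideanSpace ℝ (Fin 3)) (f p) v)).2 = v := by
  rw [Trivialization.symmL_apply _ (FiberBundle.mem_baseSet_trivializationAt' (f p))]
  exact FiberBundle.extend_apply_self (EuclideanSpace ℝ (Fin 3)) v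

lemma covAlong_add (h : DiffAlongAt f V p) (h' : DiffAlongAt f V' p) :
    covAlong cov f (fun q ↦ V q + V' q) p = covAlong cov f V p + covAlong cov f V' p := by
  have e1 : coordAlong f p (fun q ↦ V q + V' q) =ᶠ[𝓝 p] coordAlong f p V + coordAlong f p V' := by
    filter_upwards [eventually_mem_baseSet h.base.continuousAt] with q hq
    exact triv_add _ _ hq _ _
  have e2 : mvfderiv (𝓡 2) (coordAlong f p (fun q ↦ V q + V' q)) p =
      mvfderiv (𝓡 2) (coordAlong f p V) p + mvfderiv (𝓡 2) (coordAlong f p V') p := by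
    rw [← mvfderiv_add h.coord h'.coord]
    simp only [mvfderiv]
    rw [e1.mfderiv_eq]
    rw [e1.eq_of_nhds]
  unfold covAlong
  rw [e2, cov_extend_add]
  ext u
  simp
  abel

lemma covAlong_smul {g : S → ℝ} (h : DiffAlongAt f V p) (hg : MDifferentiableAt (𝓡 2) 𝓘(ℝ, ℝ) g p) :
    covAlong cov f (fun q ↦ g q • V q) p =
      g p • covAlong cov f V p + (mvfderiv (𝓡 2) g p).smulRight (V p) := by
  have e1 : coordAlong f p (fun q ↦ g q • V q) =ᶠ[𝓝 p] g • coordAlong f p V := by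
    filter_upwards [eventually_mem_baseSet h.base.continuousAt] with q hq
    exact triv_smul _ _ hq _ _
  have e2 : mvfderiv (𝓡 2) (coordAlong f p (fun q ↦ g q • V q)) p =
      g p • mvfderiv (𝓡 2) (coordAlong f p V) p +
        (mvfderiv (𝓡 2) g p).smulRight (coordAlong f p V p) := by
    rw [← mvfderiv_smul hg h.coord]
    simp only [mvfderiv]
    rw [e1.mfderiv_eq]
    rw [e1.eq_of_nhds]
  have e3 := symmL_coordAlong (V p)
  unfold covAlong
  rw [e2, cov_extend_smul]
  ext1 u
  simp only [ContinuousLinearMap.comp_add, add_apply,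
    ContinuousLinearMap.comp_apply, smul_apply, map_smul,
    ContinuousLinearMap.smulRight_apply, coordAlong, e3, smul_add]
  abel

lemma cov_eq {Y : ∀ x : M, TangentSpace (𝓡 3) x} {x : M}
    (hY : MDifferentiableAt (𝓡 3) (𝓡 3).tangent
      (fun x ↦ TotalSpace.mk' (EuclideanSpace ℝ (Fin 3)) x (Y x)) x) :
    cov Y x = (trivializationAt (EuclideanSpace ℝ (Fin 3))
        (TangentSpace (𝓡 3) : M → Type _) x).symmL ℝ x ∘L
      mvfderiv (𝓡 3) (fun y ↦ (trivializationAt (EuclideanSpace ℝ (Fin 3))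
        (TangentSpace (𝓡 3) : M → Type _) x
        (TotalSpace.mk' (EuclideanSpace ℝ (Fin 3)) y (Y y))).2) x +
      cov (FiberBundle.extend (EuclideanSpace ℝ (Fin 3)) (Y x)) x := by
  set t := trivializationAt (EuclideanSpace ℝ (Fin 3)) (TangentSpace (𝓡 3) : M → Type _) x
    with ht
  let c : (∀ x : M, TangentSpace (𝓡 3) x) → M → EuclideanSpace ℝ (Fin 3) := fun Z y ↦
    (t (TotalSpace.mk' (EuclideanSpace ℝ (Fin 3)) y (Z y))).2
  have hc : ∀ {Z : ∀ x : M, TangentSpace (𝓡 3) x}, MDifferentiableAt (𝓡 3) (𝓡 3).tangent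
      (fun x ↦ TotalSpace.mk' (EuclideanSpace ℝ (Fin 3)) x (Z x)) x →
      MDifferentiableAt (𝓡 3) 𝓘(ℝ, EuclideanSpace ℝ (Fin 3)) (c Z) x :=
    fun h ↦ ((mdifferentiableAt_totalSpace (𝓡 3) _).1 h).2
  have hmem : ∀ᶠ y in 𝓝 x, y ∈ t.baseSet :=
    t.open_baseSet.mem_nhds (FiberBundle.mem_baseSet_trivializationAt' x)
  have hx := FiberBundle.mem_baseSet_trivializationAt (EuclideanSpace ℝ (Fin 3))
    (TangentSpace (𝓡 3) : M → Type _) x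
  let Φ : (∀ x : M, TangentSpace (𝓡 3) x) → (TangentSpace (𝓡 3) x →L[ℝ] TangentSpace (𝓡 3) x) :=
    fun Z ↦ cov Z x - t.symmL ℝ x ∘L mvfderiv (𝓡 3) (c Z) x
  have hΦ : TensorialAt (𝓡 3) (EuclideanSpace ℝ (Fin 3)) Φ x := by
    refine ⟨fun {g Z} hg hZ ↦ ?_, fun {Z Z'} hZ hZ' ↦ ?_⟩
    · have e1 : c (g • Z) =ᶠ[𝓝 x] g • c Z := by
        filter_upwards [hmem] with y hy
        exact triv_smul _ _ hy _ _
      have e2 : mvfderiv (𝓡 3) (c (g • Z)) x = g x • mvfderiv (𝓡 3) (c Z) x +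
          (mvfderiv (𝓡 3) g x).smulRight (c Z x) := by
        rw [← mvfderiv_smul hg (hc hZ)]
        simp only [mvfderiv]
        rw [e1.mfderiv_eq]
        rw [e1.eq_of_nhds]
      have e3 : t.symmL ℝ x (c Z x) = Z x := by
        rw [Trivialization.symmL_apply _ hx]
        exact FiberBundle.extend_apply_self (EuclideanSpace ℝ (Fin 3)) (Z x)
      have e4 := cov.isCovariantDerivativeOnUniv.leibniz hZ hg
      simp only [Φ]
      rw [e2, e4]
      ext1 u
      simp [e3, smul_sub]
    · have e1 : c (Z + Z') =ᶠ[𝓝 x] c Z + c Z' := by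
        filter_upwards [hmem] with y hy
        exact triv_add _ _ hy _ _
      have e2 : mvfderiv (𝓡 3) (c (Z + Z')) x = mvfderiv (𝓡 3) (c Z) x +
          mvfderiv (𝓡 3) (c Z') x := by
        rw [← mvfderiv_add (hc hZ) (hc hZ')]
        simp only [mvfderiv]
        rw [e1.mfderiv_eq]
        rw [e1.eq_of_nhds]
      simp only [Φ]
      rw [e2, cov.isCovariantDerivativeOnUniv.add hZ hZ']
      ext1 u
      simp
      abel
  have key := hΦ.pointwise hY (FiberBundle.mdifferentiableAt_extend (𝓡 3)
    (EuclideanSpace ℝ (Fin 3)) (Y x)) (by simp)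
  have h0 : mvfderiv (𝓡 3) (c (FiberBundle.extend (EuclideanSpace ℝ (Fin 3)) (Y x))) x = 0 := by
    have e1 : c (FiberBundle.extend (EuclideanSpace ℝ (Fin 3)) (Y x)) =ᶠ[𝓝 x]
        fun _ ↦ c Y x := by
      filter_upwards [hmem] with y hy
      simp only [c, FiberBundle.extend]
      rw [t.apply_mk_symm hy]
    simp only [mvfderiv]
    rw [e1.mfderiv_eq, mfderiv_const]
    rfl
  simp only [Φ, h0, ContinuousLinearMap.comp_zero, sub_zero] at key
  rw [← key]
  simp only [c]
  abel

lemma covAlong_comp {Y : ∀ x : M, TangentSpace (𝓡 3) x} (hf : MDifferentiableAt (𝓡 2) (𝓡 3) f p)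
    (hY : MDifferentiableAt (𝓡 3) (𝓡 3).tangent
      (fun x ↦ TotalSpace.mk' (EuclideanSpace ℝ (Fin 3)) x (Y x)) (f p)) :
    covAlong cov f (fun q ↦ Y (f q)) p = cov Y (f p) ∘L mfderiv (𝓡 2) (𝓡 3) f p := by
  rw [cov_eq cov hY, ContinuousLinearMap.add_comp, covAlong, ContinuousLinearMap.comp_assoc]
  have hY' := ((mdifferentiableAt_totalSpace (𝓡 3) _).1 hY).2
  have h : coordAlong f p (fun q ↦ Y (f q)) =
    (fun x ↦ (trivializationAt (EuclideanSpace ℝ (Fin 3)) (TangentSpace (𝓡 3) : M → Type _) (f p)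
      (TotalSpace.mk' (EuclideanSpace ℝ (Fin 3)) x (Y x))).2) ∘ f := rfl
  rw [h, mvfderiv, mfderiv_comp p hY' hf]
  rfl

lemma diffAlong_mfderiv [IsManifold (𝓡 2) ∞ S] (hf : ContMDiff (𝓡 2) (𝓡 3) ∞ f)
    {X : ∀ q : S, TangentSpace (𝓡 2) q}
    (hX : MDifferentiableAt (𝓡 2) (𝓡 2).tangent
      (fun q ↦ TotalSpace.mk' (EuclideanSpace ℝ (Fin 2)) q (X q)) p) :
    DiffAlongAt f (fun q ↦ mfderiv (𝓡 2) (𝓡 3) f q (X q)) p := by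
  have h1 : MDifferentiableAt (𝓡 2).tangent (𝓡 3).tangent (tangentMap (𝓡 2) (𝓡 3) f)
      (TotalSpace.mk' (EuclideanSpace ℝ (Fin 2)) p (X p)) :=
    (hf.contMDiff_tangentMap (m := 1) (by decide)).mdifferentiable (by norm_num) _
  exact h1.comp p hX

lemma mfderiv_injective_of_charts {F : Type*} [NormedAddCommGroup F] [NormedSpace ℝ F]
    [IsManifold (𝓡 2) ∞ S] (hfp : MDifferentiableAt (𝓡 2) (𝓡 3) f p)
    (e : (EuclideanSpace ℝ (Fin 2) × F) ≃L[ℝ] EuclideanSpace ℝ (Fin 3))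
    (d : OpenPartialHomeomorph S (EuclideanSpace ℝ (Fin 2)))
    (c : OpenPartialHomeomorph M (EuclideanSpace ℝ (Fin 3)))
    (hd : d ∈ IsManifold.maximalAtlas (𝓡 2) ∞ S) (hc : c ∈ IsManifold.maximalAtlas (𝓡 3) ∞ M)
    (hp : p ∈ d.source) (hp' : f p ∈ c.source)
    (h : ∀ q ∈ d.source, c (f q) = e (d q, 0)) :
    Function.Injective (mfderiv (𝓡 2) (𝓡 3) f p) := by
  let G : M → S := d.symm ∘ (fun x ↦ (e.symm x).1) ∘ c
  have key : ∀ q ∈ d.source, (e.symm (c (f q))).1 = d q := by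
    intro q hq
    rw [h q hq, ContinuousLinearEquiv.symm_apply_apply]
  have hG : MDifferentiableAt (𝓡 3) (𝓡 2) G (f p) := by
    have e1 : MDifferentiableAt (𝓡 3) (𝓡 3) c (f p) :=
      (contMDiffAt_of_mem_maximalAtlas hc hp').mdifferentiableAt (by decide)
    have e2 : MDifferentiableAt (𝓡 3) (𝓡 2) (fun x ↦ (e.symm x).1) (c (f p)) := by
      refine DifferentiableAt.mdifferentiableAt ?_
      exact (differentiable_fst.comp e.symm.differentiable).differentiableAt
    have e3 : MDifferentiableAt (𝓡 2) (𝓡 2) d.symm ((e.symm (c (f p))).1) := by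
      rw [key p hp]
      exact (contMDiffAt_symm_of_mem_maximalAtlas hd (d.map_source hp)).mdifferentiableAt
        (by decide)
    exact e3.comp (f p) (e2.comp (f p) e1)
  have hid : G ∘ f =ᶠ[𝓝 p] id := by
    filter_upwards [d.open_source.mem_nhds hp] with q hq
    simp only [G, Function.comp_apply]
    rw [key q hq, d.left_inv hq]
    rfl
  have h2 := hid.mfderiv_eq (I := 𝓡 2) (I' := 𝓡 2)
  rw [mfderiv_comp p hG hfp, mfderiv_id] at h2
  refine Function.LeftInverse.injective (g := mfderiv (𝓡 3) (𝓡 2) G (f p)) fun u ↦ ?_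
  exact congrArg (fun A : EuclideanSpace ℝ (Fin 2) →L[ℝ] EuclideanSpace ℝ (Fin 2) ↦ A u) h2

lemma mfderiv_injective_of_isImmersion [IsManifold (𝓡 2) ∞ S]
    (hf : IsImmersion (𝓡 2) (𝓡 3) ∞ f) (p : S) :
    Function.Injective (mfderiv (𝓡 2) (𝓡 3) f p) := by
  have h := hf.isImmersionAt p
  refine mfderiv_injective_of_charts ((hf.contMDiff p).mdifferentiableAt (by decide)) h.equiv
    h.domChart h.codChart h.domChart_mem_maximalAtlas h.codChart_mem_maximalAtlas
    h.mem_domChart_source h.mem_codChart_source fun q hq ↦ ?_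
  have hq' : h.domChart q ∈ (h.domChart.extend (𝓡 2)).target := by
    simpa using h.domChart.map_source hq
  have h1 := h.writtenInCharts hq'
  simpa [h.domChart.left_inv hq] using h1

end Along

section Ambient

instance {M : Type*} [TopologicalSpace M] [ChartedSpace (EuclideanSpace ℝ (Fin 3)) M] (x : M) :
    FiniteDimensional ℝ (TangentSpace (𝓡 3) x) :=
  inferInstanceAs (FiniteDimensional ℝ (EuclideanSpace ℝ (Fin 3)))

variable {M : Type*} [TopologicalSpace M] [ChartedSpace (EuclideanSpace ℝ (Fin 3)) M]

instance (x : M) : Fact (Module.finrank ℝ (TangentSpace (𝓡 3) x) = 3) :=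
  ⟨(finrank_euclideanSpace_fin : Module.finrank ℝ (EuclideanSpace ℝ (Fin 3)) = 3)⟩

variable [IsManifold (𝓡 3) ∞ M]

/-- A smooth orientation of a 3-manifold: an orientation of every tangent space such that near
every point there is a smooth positively oriented frame. -/
structure ManifoldOrientation (M : Type*) [TopologicalSpace M]
    [ChartedSpace (EuclideanSpace ℝ (Fin 3)) M] [IsManifold (𝓡 3) ∞ M] where
  /-- the orientation of each tangent space -/
  toFun : ∀ x : M, Orientation ℝ (TangentSpace (𝓡 3) x) (Fin 3)
  exists_frame : ∀ x : M, ∃ U ∈ 𝓝 x, ∃ E : Fin 3 → ∀ y : M, TangentSpace (𝓡 3) y,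
    (∀ i, ContMDiffOn (𝓡 3) (𝓡 3).tangent ∞
      (fun y ↦ TotalSpace.mk' (EuclideanSpace ℝ (Fin 3)) y (E i y)) U) ∧
    ∀ y ∈ U, ∃ b : Module.Basis (Fin 3) ℝ (TangentSpace (𝓡 3) y),
      (∀ i, b i = E i y) ∧ b.orientation = toFun y

variable (cov : CovariantDerivative (𝓡 3) (EuclideanSpace ℝ (Fin 3))
  (TangentSpace (𝓡 3) : M → Type _))

/-- `R(X, Y) Z = ∇_X ∇_Y Z - ∇_Y ∇_X Z - ∇_[X, Y] Z` for vector fields. -/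
def curvatureField (X Y Z : ∀ x : M, TangentSpace (𝓡 3) x) (x : M) : TangentSpace (𝓡 3) x :=
  cov (fun y ↦ cov Z y (Y y)) x (X x) - cov (fun y ↦ cov Z y (X y)) x (Y x)
    - cov Z x (VectorField.mlieBracket (𝓡 3) X Y x)

/-- The curvature tensor `R(u, v) w` at a point, computed on extensions of `u`, `v`, `w` to vector
fields that are smooth near the point; its value does not depend on the extensions. -/
def curvature (x : M) (u v w : TangentSpace (𝓡 3) x) : TangentSpace (𝓡 3) x :=
  curvatureField cov (FiberBundle.extend (EuclideanSpace ℝ (Fin 3)) u)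
    (FiberBundle.extend (EuclideanSpace ℝ (Fin 3)) v)
    (FiberBundle.extend (EuclideanSpace ℝ (Fin 3)) w) x

variable [RiemannianBundle (fun x : M ↦ TangentSpace (𝓡 3) x)]

instance [h : IsContMDiffRiemannianBundle (𝓡 3) ∞ (EuclideanSpace ℝ (Fin 3))
    (fun x : M ↦ TangentSpace (𝓡 3) x)] :
    IsContMDiffRiemannianBundle (𝓡 3) 1 (EuclideanSpace ℝ (Fin 3))
      (fun x : M ↦ TangentSpace (𝓡 3) x) :=
  h.of_le (by norm_num)

end Ambient

section Alternating

variable {V : Type*} [AddCommGroup V] [Module ℝ V] (f : V [⋀^Fin 3]→ₗ[ℝ] ℝ) (x a b c : V) (r : ℝ)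

lemma update_mid : Function.update ![x, 0, c] 1 a = ![x, a, c] := by
  ext i; fin_cases i <;> rfl

lemma update_right : Function.update ![x, a, 0] 2 b = ![x, a, b] := by
  ext i; fin_cases i <;> rfl

lemma alternating_add_mid : f ![x, a + b, c] = f ![x, a, c] + f ![x, b, c] := by
  have h := f.map_update_add ![x, 0, c] 1 a b
  simpa only [update_mid] using h

lemma alternating_smul_mid : f ![x, r • a, c] = r • f ![x, a, c] := by
  have h := f.map_update_smul ![x, 0, c] 1 r a
  simpa only [update_mid] using h

lemma alternating_add_right : f ![x, a, b + c] = f ![x, a, b] + f ![x, a, c] := by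
  have h := f.map_update_add ![x, a, 0] 2 b c
  simpa only [update_right] using h

lemma alternating_smul_right : f ![x, a, r • b] = r • f ![x, a, b] := by
  have h := f.map_update_smul ![x, a, 0] 2 r b
  simpa only [update_right] using h

end Alternating

section Surface

instance {S : Type*} [TopologicalSpace S] [ChartedSpace (EuclideanSpace ℝ (Fin 2)) S] (p : S) :
    FiniteDimensional ℝ (TangentSpace (𝓡 2) p) :=
  inferInstanceAs (FiniteDimensional ℝ (EuclideanSpace ℝ (Fin 2)))

/-- A surface smoothly embedded in the Riemannian 3-manifold `M`, together with a smooth unit normal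
field `N` along it (equivalently, for an oriented `M`, an oriented embedded surface). -/
structure OrientedSurface (M : Type*) [TopologicalSpace M]
    [ChartedSpace (EuclideanSpace ℝ (Fin 3)) M] [IsManifold (𝓡 3) ∞ M]
    [RiemannianBundle (fun x : M ↦ TangentSpace (𝓡 3) x)]
    (S : Type*) [TopologicalSpace S] [ChartedSpace (EuclideanSpace ℝ (Fin 2)) S]
    [IsManifold (𝓡 2) ∞ S] where
  /-- the inclusion of the surface -/
  incl : S → M
  isSmoothEmbedding : IsSmoothEmbedding (𝓡 2) (𝓡 3) ∞ incl
  /-- the unit normal field -/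
  N : ∀ p : S, TangentSpace (𝓡 3) (incl p)
  smooth_N : ContMDiff (𝓡 2) (𝓡 3).tangent ∞
    (fun p ↦ TotalSpace.mk' (EuclideanSpace ℝ (Fin 3)) (incl p) (N p))
  norm_N : ∀ p, ‖N p‖ = 1
  inner_N : ∀ (p : S) (u : TangentSpace (𝓡 2) p), inner ℝ (N p) (mfderiv (𝓡 2) (𝓡 3) incl p u) = 0

namespace OrientedSurface

variable {M : Type*} [TopologicalSpace M] [ChartedSpace (EuclideanSpace ℝ (Fin 3)) M]
  [IsManifold (𝓡 3) ∞ M] [RiemannianBundle (fun x : M ↦ TangentSpace (𝓡 3) x)]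
  {S : Type*} [TopologicalSpace S] [ChartedSpace (EuclideanSpace ℝ (Fin 2)) S]
  [IsManifold (𝓡 2) ∞ S] (Γ : OrientedSurface M S)

/-- The differential of the inclusion. -/
abbrev d (p : S) : TangentSpace (𝓡 2) p →L[ℝ] TangentSpace (𝓡 3) (Γ.incl p) :=
  mfderiv (𝓡 2) (𝓡 3) Γ.incl p

lemma d_injective (p : S) : Function.Injective (Γ.d p) :=
  mfderiv_injective_of_isImmersion Γ.isSmoothEmbedding.isImmersion p

/-- The induced Riemannian metric of the surface. -/
def metric (p : S) : LinearMap.BilinForm ℝ (TangentSpace (𝓡 2) p) :=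
  (innerₗ (TangentSpace (𝓡 3) (Γ.incl p))).compl₁₂ (Γ.d p).toLinearMap (Γ.d p).toLinearMap

lemma metric_apply (p : S) (u v : TangentSpace (𝓡 2) p) :
    Γ.metric p u v = inner ℝ (Γ.d p u) (Γ.d p v) := rfl

lemma metric_nondegenerate (p : S) : (Γ.metric p).Nondegenerate := by
  have h : ∀ u, Γ.metric p u u = 0 → u = 0 := fun u hu ↦ by
    rw [metric_apply, inner_self_eq_zero] at hu
    exact (injective_iff_map_eq_zero (Γ.d p)).1 (Γ.d_injective p) u hu
  exact ⟨fun u hu ↦ h u (hu u), fun u hu ↦ h u (hu u)⟩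

/-- Raising an index: `Γ.sharp p α` is the tangent vector `u` with `⟨u, v⟩ = α v` for all `v`. -/
def sharp (p : S) : (TangentSpace (𝓡 2) p →ₗ[ℝ] ℝ) →ₗ[ℝ] TangentSpace (𝓡 2) p :=
  ((Γ.metric p).toDual (Γ.metric_nondegenerate p)).symm.toLinearMap

lemma metric_sharp (p : S) (α : TangentSpace (𝓡 2) p →ₗ[ℝ] ℝ) (v : TangentSpace (𝓡 2) p) :
    Γ.metric p (Γ.sharp p α) v = α v :=
  LinearMap.BilinForm.apply_toDual_symm_apply (hB := Γ.metric_nondegenerate p) α v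

lemma sharp_metric (p : S) (u : TangentSpace (𝓡 2) p) : Γ.sharp p (Γ.metric p u) = u :=
  ((Γ.metric p).toDual (Γ.metric_nondegenerate p)).symm_apply_apply u

/-- The component tangent to the surface of a vector of the ambient manifold. -/
def tang (p : S) : TangentSpace (𝓡 3) (Γ.incl p) →L[ℝ] TangentSpace (𝓡 2) p :=
  LinearMap.toContinuousLinearMap (Γ.sharp p ∘ₗ
    (innerₗ (TangentSpace (𝓡 3) (Γ.incl p))).compl₁₂ LinearMap.id (Γ.d p).toLinearMap)

lemma tang_d (p : S) (u : TangentSpace (𝓡 2) p) : Γ.tang p (Γ.d p u) = u :=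
  Γ.sharp_metric p u

/-- The area form `dA(u, v) = vol(N, u, v)` of the surface, oriented so that `(u, v)` is positive if
and only if `(N, u, v)` is positive in `M`. -/
def area (o : ManifoldOrientation M) (p : S) : LinearMap.BilinForm ℝ (TangentSpace (𝓡 2) p) :=
  LinearMap.mk₂ ℝ
    (fun u v ↦ (o.toFun (Γ.incl p)).volumeForm ![Γ.N p, Γ.d p u, Γ.d p v])
    (fun u u' v ↦ by rw [map_add, alternating_add_mid])
    (fun c u v ↦ by rw [map_smul, alternating_smul_mid])
    (fun u v v' ↦ by rw [map_add, alternating_add_right])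
    (fun c u v ↦ by rw [map_smul, alternating_smul_right])

/-- The complex structure `J u = N × u`, that is `⟨J u, v⟩ = dA(u, v)`. -/
def J (o : ManifoldOrientation M) (p : S) : TangentSpace (𝓡 2) p →ₗ[ℝ] TangentSpace (𝓡 2) p :=
  Γ.sharp p ∘ₗ Γ.area o p

variable (cov : CovariantDerivative (𝓡 3) (EuclideanSpace ℝ (Fin 3))
  (TangentSpace (𝓡 3) : M → Type _))

/-- The ambient covariant derivative `u ↦ ∇_u Y` of a vector field `Y` tangent to the surface. -/
def ambientCov (Y : ∀ q : S, TangentSpace (𝓡 2) q) (p : S) :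
    TangentSpace (𝓡 2) p →L[ℝ] TangentSpace (𝓡 3) (Γ.incl p) :=
  covAlong cov Γ.incl (fun q ↦ Γ.d q (Y q)) p

lemma diffAlong {Y : ∀ q : S, TangentSpace (𝓡 2) q} {p : S}
    (hY : MDifferentiableAt (𝓡 2) (𝓡 2).tangent
      (fun q ↦ TotalSpace.mk' (EuclideanSpace ℝ (Fin 2)) q (Y q)) p) :
    DiffAlongAt Γ.incl (fun q ↦ Γ.d q (Y q)) p :=
  diffAlong_mfderiv Γ.isSmoothEmbedding.contMDiff hY

lemma ambientCov_add {Y Y' : ∀ q : S, TangentSpace (𝓡 2) q} {p : S}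
    (hY : MDifferentiableAt (𝓡 2) (𝓡 2).tangent
      (fun q ↦ TotalSpace.mk' (EuclideanSpace ℝ (Fin 2)) q (Y q)) p)
    (hY' : MDifferentiableAt (𝓡 2) (𝓡 2).tangent
      (fun q ↦ TotalSpace.mk' (EuclideanSpace ℝ (Fin 2)) q (Y' q)) p) :
    Γ.ambientCov cov (Y + Y') p = Γ.ambientCov cov Y p + Γ.ambientCov cov Y' p := by
  rw [ambientCov, ambientCov, ambientCov, ← covAlong_add cov (Γ.diffAlong hY) (Γ.diffAlong hY')]
  congr 1
  funext q
  exact map_add _ _ _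

lemma ambientCov_smul {g : S → ℝ} {Y : ∀ q : S, TangentSpace (𝓡 2) q} {p : S}
    (hg : MDifferentiableAt (𝓡 2) 𝓘(ℝ, ℝ) g p)
    (hY : MDifferentiableAt (𝓡 2) (𝓡 2).tangent
      (fun q ↦ TotalSpace.mk' (EuclideanSpace ℝ (Fin 2)) q (Y q)) p) :
    Γ.ambientCov cov (g • Y) p = g p • Γ.ambientCov cov Y p +
      (mvfderiv (𝓡 2) g p).smulRight (Γ.d p (Y p)) := by
  rw [ambientCov, ambientCov, ← covAlong_smul cov (Γ.diffAlong hY) hg]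
  congr 1
  funext q
  exact (Γ.d q).map_smul _ _

/-- The induced connection of the surface: `∇_X Y` is the tangential component of the ambient
covariant derivative. -/
def inducedConnection : CovariantDerivative (𝓡 2) (EuclideanSpace ℝ (Fin 2))
    (TangentSpace (𝓡 2) : S → Type _) where
  toFun Y p := Γ.tang p ∘L Γ.ambientCov cov Y p
  isCovariantDerivativeOnUniv :=
    { add := fun {Y Y' p} hY hY' _ ↦ by
        rw [Γ.ambientCov_add cov hY hY', ContinuousLinearMap.comp_add]
      leibniz := fun {Y g p} hY hg _ ↦ by
        rw [Γ.ambientCov_smul cov hg hY]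
        ext1 u
        simp [tang_d] }

lemma tensorial_normal (p : S) :
    TensorialAt (𝓡 2) (EuclideanSpace ℝ (Fin 2))
      (fun Y : ∀ q : S, TangentSpace (𝓡 2) q ↦ innerSL ℝ (Γ.N p) ∘L Γ.ambientCov cov Y p) p where
  smul hg hY := by
    rw [Γ.ambientCov_smul cov hg hY]
    ext1 u
    simp [Γ.inner_N]
  add hY hY' := by
    rw [Γ.ambientCov_add cov hY hY', ContinuousLinearMap.comp_add]

/-- The second fundamental form `II(X, Y) = ⟨N, ∇_X Y⟩`, where `∇` is the ambient connection. It is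
tensorial, and in general not symmetric. -/
def II (p : S) : LinearMap.BilinForm ℝ (TangentSpace (𝓡 2) p) :=
  LinearMap.mk₂ ℝ (fun u v ↦ TensorialAt.mkHom _ p (Γ.tensorial_normal cov p) v u)
    (fun u u' v ↦ map_add _ u u') (fun c u v ↦ map_smul _ c u)
    (fun u v v' ↦ by rw [map_add]; rfl) (fun c u v ↦ by rw [map_smul]; rfl)

lemma II_apply {Y : ∀ q : S, TangentSpace (𝓡 2) q} {p : S}
    (hY : MDifferentiableAt (𝓡 2) (𝓡 2).tangent
      (fun q ↦ TotalSpace.mk' (EuclideanSpace ℝ (Fin 2)) q (Y q)) p) (u : TangentSpace (𝓡 2) p) :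
    Γ.II cov p u (Y p) = inner ℝ (Γ.N p) (Γ.ambientCov cov Y p u) := by
  rw [II, LinearMap.mk₂_apply, TensorialAt.mkHom_apply _ hY]
  rfl

/-- The Weingarten map: `⟨W X, Y⟩ = II(X, Y)`. -/
def W (p : S) : TangentSpace (𝓡 2) p →ₗ[ℝ] TangentSpace (𝓡 2) p :=
  Γ.sharp p ∘ₗ Γ.II cov p

/-- The third fundamental form `III(X, Y) = ⟨W X, W Y⟩`. -/
def III (p : S) : LinearMap.BilinForm ℝ (TangentSpace (𝓡 2) p) :=
  (Γ.metric p).compl₁₂ (Γ.W cov p) (Γ.W cov p)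

/-- The mean curvature `H = tr W`. -/
def meanCurvature (p : S) : ℝ :=
  LinearMap.trace ℝ (TangentSpace (𝓡 2) p) (Γ.W cov p)

/-- The 2-form `τ(X, Y) = ⟨N, T(X, Y)⟩`, where `T` is the torsion of the ambient connection. -/
def τ (p : S) (u v : TangentSpace (𝓡 2) p) : ℝ :=
  inner ℝ (Γ.N p) (cov.torsion (Γ.incl p) (Γ.d p u) (Γ.d p v))

/-- The Hodge dual of `τ`, that is the function `⋆τ` with `τ = (⋆τ) dA`. -/
def starτ (o : ManifoldOrientation M) (p : S) : ℝ :=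
  let b : Fin 2 → TangentSpace (𝓡 2) p := EuclideanSpace.basisFun (Fin 2) ℝ
  Γ.τ cov p (b 0) (b 1) / Γ.area o p (b 0) (b 1)

/-- The complex mean curvature `H + i ⋆τ`. -/
def complexMeanCurvature (o : ManifoldOrientation M) (p : S) : ℂ :=
  Γ.meanCurvature cov p + Complex.I * Γ.starτ cov o p

/-- The tensor `L(X, Y) = R(X, Y) N - J W J T(X, Y)`, where `R` is the curvature of the ambient
connection and `T` the torsion of the induced connection of the surface. -/
def L (o : ManifoldOrientation M) (p : S) (u v : TangentSpace (𝓡 2) p) :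
    TangentSpace (𝓡 3) (Γ.incl p) :=
  curvature cov (Γ.incl p) (Γ.d p u) (Γ.d p v) (Γ.N p)
    - Γ.d p (Γ.J o p (Γ.W cov p (Γ.J o p ((Γ.inducedConnection cov).torsion p u v))))

end OrientedSurface

end Surface

section Complex

variable {S : Type*} [TopologicalSpace S] [ChartedSpace (EuclideanSpace ℝ (Fin 2)) S]
  [IsManifold (𝓡 2) ∞ S]

/-- A complex coordinate `z` on an open subset of a surface with almost complex structure `J`: a
diffeomorphism onto an open subset of `ℂ` with `dz ∘ J = i dz`. -/
structure IsComplexChart (J : ∀ p : S, TangentSpace (𝓡 2) p →ₗ[ℝ] TangentSpace (𝓡 2) p)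
    (z : OpenPartialHomeomorph S ℂ) : Prop where
  smooth : ContMDiffOn (𝓡 2) 𝓘(ℝ, ℂ) ∞ z z.source
  smooth_symm : ContMDiffOn 𝓘(ℝ, ℂ) (𝓡 2) ∞ z.symm z.target
  map_J : ∀ p ∈ z.source, ∀ u : TangentSpace (𝓡 2) p,
    mvfderiv (𝓡 2) z p (J p u) = Complex.I * mvfderiv (𝓡 2) z p u

/-- A complex function on the surface is holomorphic if it is so in all complex coordinates. -/
def IsHolomorphic (J : ∀ p : S, TangentSpace (𝓡 2) p →ₗ[ℝ] TangentSpace (𝓡 2) p)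
    (h : S → ℂ) : Prop :=
  ∀ z : OpenPartialHomeomorph S ℂ, IsComplexChart J z →
    DifferentiableOn ℂ (h ∘ z.symm) z.target

/-- The complexified tangent vector `∂z = (∂x - i ∂y) / 2` of the coordinate `z = x + i y`. -/
def wirtinger (z : OpenPartialHomeomorph S ℂ) (ζ : ℂ) :
    ℂ ⊗[ℝ] TangentSpace (𝓡 2) (z.symm ζ) :=
  let dz : ℂ →L[ℝ] TangentSpace (𝓡 2) (z.symm ζ) := mfderiv 𝓘(ℝ, ℂ) (𝓡 2) z.symm ζ
  (1 / 2 : ℂ) ⊗ₜ[ℝ] dz 1 - (Complex.I / 2) ⊗ₜ[ℝ] dz Complex.I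

/-- The coefficient `B(∂z, ∂z)` of the quadratic differential `B(∂z, ∂z) dz²` in the coordinate `z`,
as a function on the image of `z`; the bilinear form `B` is extended complex bilinearly. -/
def quadCoeff (B : ∀ p : S, LinearMap.BilinForm ℝ (TangentSpace (𝓡 2) p))
    (z : OpenPartialHomeomorph S ℂ) (ζ : ℂ) : ℂ :=
  LinearMap.BilinForm.baseChange ℂ (B (z.symm ζ)) (wirtinger z ζ) (wirtinger z ζ)

/-- A family of coefficients `q z`, one for each complex coordinate `z`, defines a holomorphic
quadratic differential `q z dz²`: the expressions `q z dz²` agree where coordinates overlap, and all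
`q z` are holomorphic. -/
structure IsHolomorphicQuadraticDifferential
    (J : ∀ p : S, TangentSpace (𝓡 2) p →ₗ[ℝ] TangentSpace (𝓡 2) p)
    (q : OpenPartialHomeomorph S ℂ → ℂ → ℂ) : Prop where
  transform : ∀ z w : OpenPartialHomeomorph S ℂ, IsComplexChart J z → IsComplexChart J w →
    ∀ p ∈ z.source ∩ w.source, q z (z p) = q w (w p) * deriv (w ∘ z.symm) (z p) ^ 2
  holomorphic : ∀ z : OpenPartialHomeomorph S ℂ, IsComplexChart J z →
    DifferentiableOn ℂ (q z) z.target

end Complex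

end RiemannCartan

end

noncomputable section

/-! In a complex chart z = x + iy the metric is conformal: ∂x and ∂y are orthogonal of the same
square length l. Write h₁₁ = II(∂x, ∂x), h₁₂ = II(∂x, ∂y), and so on; II need not be symmetric, and
⟨N, T̃(∂x, ∂y)⟩ = h₁₂ - h₂₁. Hence 𝑯 = (h₁₁ + h₂₂ + i (h₁₂ - h₂₁)) / l, that is, II(∂z, ∂z̄) = l 𝑯 /
4, while φ has the coefficient (h₁₁ - h₂₂ - i (h₁₂ + h₂₁)) / 4.

For (a), the Weingarten equation ∇̃N = -W turns the tangential part of R̃(∂x, ∂y)N into the Codazzi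
expression in the first derivatives of the h's. Metric compatibility fixes the part dl/2 of the
connection coefficients but leaves the rotation coefficients θ(u) = ⟨∇̃_u ∂x, ∂y⟩ free. They enter
both the Codazzi expression and the torsion T of the surface, and J W J T is exactly the term that
removes them. So L = 0 leaves two real equations in the h's, l and dl (`codazzi`). Together they say
that φ_z̄ equals l/4 times the complex conjugate of 𝑯_z̄, where φ denotes the coefficient. Thus the
Cauchy–Riemann equations for 𝑯 and for φ hold at the same points
(`differentiableAt_complexMeanCurvature_iff`).

For (b), W∂z = (𝑯/2) ∂z + (2φ/l) ∂z̄ and ⟨∂z, ∂z⟩ = 0, ⟨∂z, ∂z̄⟩ = l/2, so that ψ = 𝑯 φ without any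
hypothesis on L (`quadValue_III`). A product of holomorphic functions is holomorphic.

The remaining work is a calculus of vector fields along a map f : S → M. Such a field is expanded in
a coordinate frame of M, which gives the product rule for inner products (`innerRule_covAlong`), the
torsion (`covAlong_sub_eq_torsion`) and the curvature (`covAlong_covAlong_sub`) without extending
fields from S to M. -/

namespace RiemannCartan

/-! ### Covariant differentiation of vector fields along a map -/

section AlongCalculus

variable {M : Type*} [TopologicalSpace M] [ChartedSpace (EuclideanSpace ℝ (Fin 3)) M]
  [IsManifold (𝓡 3) ∞ M]
  {S : Type*} [TopologicalSpace S] [ChartedSpace (EuclideanSpace ℝ (Fin 2)) S]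

/-- Differentiability of a vector field at a point. -/
abbrev DiffFieldAt (Y : ∀ x : M, TangentSpace (𝓡 3) x) (x : M) : Prop :=
  MDifferentiableAt (𝓡 3) (𝓡 3).tangent
    (fun x ↦ TotalSpace.mk' (EuclideanSpace ℝ (Fin 3)) x (Y x)) x

/-- The vector field `V` along `f` is differentiable at `p`, with covariant derivative `A`. -/
structure HasCovAlong (cov : CovariantDerivative (𝓡 3) (EuclideanSpace ℝ (Fin 3))
      (TangentSpace (𝓡 3) : M → Type _)) (f : S → M) (V : ∀ q : S, TangentSpace (𝓡 3) (f q)) (p : S)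
    (A : TangentSpace (𝓡 2) p →L[ℝ] TangentSpace (𝓡 3) (f p)) : Prop where
  diff : DiffAlongAt f V p
  covAlong_eq : covAlong cov f V p = A

variable {cov : CovariantDerivative (𝓡 3) (EuclideanSpace ℝ (Fin 3))
      (TangentSpace (𝓡 3) : M → Type _)} {f : S → M} {p : S}
   {V V' : ∀ q : S, TangentSpace (𝓡 3) (f q)}
   {A A' : TangentSpace (𝓡 2) p →L[ℝ] TangentSpace (𝓡 3) (f p)}

lemma diffAlongAt_iff : DiffAlongAt f V p ↔ MDifferentiableAt (𝓡 2) (𝓡 3) f p ∧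
    MDifferentiableAt (𝓡 2) 𝓘(ℝ, EuclideanSpace ℝ (Fin 3)) (coordAlong f p V) p :=
  mdifferentiableAt_totalSpace (𝓡 3) _

lemma coordAlong_add (hf : ContinuousAt f p) :
    coordAlong f p (fun q ↦ V q + V' q) =ᶠ[𝓝 p] coordAlong f p V + coordAlong f p V' := by
  filter_upwards [eventually_mem_baseSet hf] with q hq
  exact triv_add _ _ hq _ _

lemma coordAlong_smul (g : S → ℝ) (hf : ContinuousAt f p) :
    coordAlong f p (fun q ↦ g q • V q) =ᶠ[𝓝 p] g • coordAlong f p V := by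
  filter_upwards [eventually_mem_baseSet hf] with q hq
  exact triv_smul _ _ hq _ _

lemma DiffAlongAt.add (h : DiffAlongAt f V p) (h' : DiffAlongAt f V' p) :
    DiffAlongAt f (fun q ↦ V q + V' q) p :=
  diffAlongAt_iff.2 ⟨h.base,
    (h.coord.add h'.coord).congr_of_eventuallyEq (coordAlong_add h.base.continuousAt)⟩

lemma DiffAlongAt.smul {g : S → ℝ} (h : DiffAlongAt f V p)
    (hg : MDifferentiableAt (𝓡 2) 𝓘(ℝ, ℝ) g p) : DiffAlongAt f (fun q ↦ g q • V q) p :=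
  diffAlongAt_iff.2 ⟨h.base,
    (hg.smul h.coord).congr_of_eventuallyEq (coordAlong_smul g h.base.continuousAt)⟩

lemma DiffAlongAt.congr (h : DiffAlongAt f V p) (e : ∀ᶠ q in 𝓝 p, V' q = V q) :
    DiffAlongAt f V' p := by
  refine MDifferentiableAt.congr_of_eventuallyEq h ?_
  filter_upwards [e] with q hq
  rw [hq]

lemma HasCovAlong.congr (h : HasCovAlong cov f V p A) (e : ∀ᶠ q in 𝓝 p, V' q = V q) :
    HasCovAlong cov f V' p A := by
  refine ⟨h.diff.congr e, ?_⟩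
  rw [← h.covAlong_eq]
  have e1 : coordAlong f p V' =ᶠ[𝓝 p] coordAlong f p V := by
    filter_upwards [e] with q hq
    simp only [coordAlong, hq]
  unfold covAlong
  rw [e.self_of_nhds]
  simp only [mvfderiv]
  rw [e1.mfderiv_eq, e1.eq_of_nhds]

lemma HasCovAlong.add (h : HasCovAlong cov f V p A) (h' : HasCovAlong cov f V' p A') :
    HasCovAlong cov f (fun q ↦ V q + V' q) p (A + A') :=
  ⟨h.diff.add h'.diff, by rw [covAlong_add cov h.diff h'.diff, h.covAlong_eq, h'.covAlong_eq]⟩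

lemma HasCovAlong.smul {g : S → ℝ} (h : HasCovAlong cov f V p A)
    (hg : MDifferentiableAt (𝓡 2) 𝓘(ℝ, ℝ) g p) :
    HasCovAlong cov f (fun q ↦ g q • V q) p (g p • A + (mvfderiv (𝓡 2) g p).smulRight (V p)) :=
  ⟨h.diff.smul hg, by rw [covAlong_smul cov h.diff hg, h.covAlong_eq]⟩

lemma HasCovAlong.comp {Y : ∀ x : M, TangentSpace (𝓡 3) x} (hf : MDifferentiableAt (𝓡 2) (𝓡 3) f p)
    (hY : DiffFieldAt Y (f p)) :
    HasCovAlong cov f (fun q ↦ Y (f q)) p (cov Y (f p) ∘L mfderiv (𝓡 2) (𝓡 3) f p) :=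
  ⟨MDifferentiableAt.comp p hY hf, covAlong_comp cov hf hY⟩

lemma HasCovAlong.zero (hf : MDifferentiableAt (𝓡 2) (𝓡 3) f p) :
    HasCovAlong cov f (fun _ ↦ 0) p 0 := by
  have h := HasCovAlong.comp (cov := cov) (Y := 0) hf (mdifferentiableAt_zeroSection ..)
  have h0 : cov 0 = 0 := cov.zero
  rw [h0] at h
  simpa using h

lemma HasCovAlong.sum {ι : Type*} (s : Finset ι) (hf : MDifferentiableAt (𝓡 2) (𝓡 3) f p)
    {V : ι → ∀ q : S, TangentSpace (𝓡 3) (f q)}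
    {A : ι → TangentSpace (𝓡 2) p →L[ℝ] TangentSpace (𝓡 3) (f p)}
    (h : ∀ i ∈ s, HasCovAlong cov f (V i) p (A i)) :
    HasCovAlong cov f (fun q ↦ ∑ i ∈ s, V i q) p (∑ i ∈ s, A i) := by
  classical
  induction s using Finset.induction_on with
  | empty => simpa using HasCovAlong.zero hf
  | insert a s ha ih =>
    simp only [Finset.sum_insert ha]
    exact (h a (Finset.mem_insert_self _ _)).add
      (ih fun i hi ↦ h i (Finset.mem_insert_of_mem hi))

end AlongCalculus

/-! ### Fields with constant components in a chart frame -/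

section ConstField

variable {M : Type*} [TopologicalSpace M] [ChartedSpace (EuclideanSpace ℝ (Fin 3)) M]
  [IsManifold (𝓡 3) ∞ M]

/-- The vector field with constant components `a` in the standard local frame near `x₀`. -/
def constField (x₀ : M) (a : EuclideanSpace ℝ (Fin 3)) (y : M) : TangentSpace (𝓡 3) y :=
  (trivializationAt (EuclideanSpace ℝ (Fin 3)) (TangentSpace (𝓡 3) : M → Type _) x₀).symm y a

/-- The domain of the standard local frame near `x₀`. -/
abbrev frameDomain (x₀ : M) : Set M :=
  (trivializationAt (EuclideanSpace ℝ (Fin 3)) (TangentSpace (𝓡 3) : M → Type _) x₀).baseSet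

lemma frameDomain_mem_nhds {x₀ y : M} (hy : y ∈ frameDomain x₀) : frameDomain x₀ ∈ 𝓝 y :=
  (trivializationAt _ _ x₀).open_baseSet.mem_nhds hy

lemma mem_frameDomain_self (x₀ : M) : x₀ ∈ frameDomain x₀ :=
  FiberBundle.mem_baseSet_trivializationAt' x₀

/-- Torsion and curvature are evaluated on the extensions `FiberBundle.extend`; this makes them
computable in the chart frame. -/
lemma extend_eq_constField {x₀ : M} (v : TangentSpace (𝓡 3) x₀) :
    FiberBundle.extend (EuclideanSpace ℝ (Fin 3)) v = constField x₀
      (trivializationAt (EuclideanSpace ℝ (Fin 3)) (TangentSpace (𝓡 3) : M → Type _) x₀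
        (TotalSpace.mk' (EuclideanSpace ℝ (Fin 3)) x₀ v)).2 := rfl

lemma constField_eq_symmL (x₀ : M) (a : EuclideanSpace ℝ (Fin 3)) {y : M}
    (hy : y ∈ frameDomain x₀) :
    constField x₀ a y = (trivializationAt (EuclideanSpace ℝ (Fin 3))
      (TangentSpace (𝓡 3) : M → Type _) x₀).symmL ℝ y a := by
  rw [Trivialization.symmL_apply _ hy]; rfl

lemma triv_constField (x₀ : M) (a : EuclideanSpace ℝ (Fin 3)) {y : M}
    (hy : y ∈ frameDomain x₀) :
    (trivializationAt (EuclideanSpace ℝ (Fin 3)) (TangentSpace (𝓡 3) : M → Type _) x₀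
        (TotalSpace.mk' (EuclideanSpace ℝ (Fin 3)) y (constField x₀ a y))).2 = a := by
  simp only [constField, TotalSpace.mk']
  rw [Trivialization.apply_mk_symm _ hy]

lemma constField_triv {x₀ y : M} (hy : y ∈ frameDomain x₀) (v : TangentSpace (𝓡 3) y) :
    constField x₀ (trivializationAt (EuclideanSpace ℝ (Fin 3))
      (TangentSpace (𝓡 3) : M → Type _) x₀ (TotalSpace.mk' (EuclideanSpace ℝ (Fin 3)) y v)).2 y
      = v := by
  simp only [constField, TotalSpace.mk']
  rw [Trivialization.symm_apply_apply_mk _ hy]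

lemma contMDiffAt_constField {x₀ y : M} (hy : y ∈ frameDomain x₀) (a : EuclideanSpace ℝ (Fin 3)) :
    ContMDiffAt (𝓡 3) (𝓡 3).tangent ∞
      (fun x ↦ TotalSpace.mk' (EuclideanSpace ℝ (Fin 3)) x (constField x₀ a x)) y := by
  have h := (trivializationAt (EuclideanSpace ℝ (Fin 3)) (TangentSpace (𝓡 3) : M → Type _)
    x₀).contMDiffAt_section_iff (n := ∞) (IB := 𝓡 3) (s := constField x₀ a) hy
  refine h.2 ((contMDiffAt_const (c := a)).congr_of_eventuallyEq ?_)
  filter_upwards [frameDomain_mem_nhds hy] with z hz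
  exact triv_constField x₀ a hz

lemma diffFieldAt_constField {x₀ y : M} (hy : y ∈ frameDomain x₀)
    (a : EuclideanSpace ℝ (Fin 3)) : DiffFieldAt (constField x₀ a) y :=
  (contMDiffAt_constField hy a).mdifferentiableAt (by simp)

/-- The `i`-th field of the standard local frame near `x₀`. -/
def frameField (x₀ : M) (i : Fin 3) : ∀ y : M, TangentSpace (𝓡 3) y :=
  constField x₀ (EuclideanSpace.single i 1)

lemma euclidean_eq_sum (a : EuclideanSpace ℝ (Fin 3)) :
    a = ∑ i, a i • EuclideanSpace.single i (1 : ℝ) := by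
  have h := (EuclideanSpace.basisFun (Fin 3) ℝ).sum_repr a
  simpa using h.symm

lemma constField_eq_sum {x₀ y : M} (hy : y ∈ frameDomain x₀) (a : EuclideanSpace ℝ (Fin 3)) :
    constField x₀ a y = ∑ i, a i • frameField x₀ i y := by
  simp only [frameField, constField_eq_symmL x₀ _ hy]
  conv_lhs => rw [euclidean_eq_sum a]
  rw [map_sum]
  simp only [map_smul]

end ConstField

lemma mvfderiv_congr {F : Type*} [NormedAddCommGroup F] [NormedSpace ℝ F]
    {S : Type*} [TopologicalSpace S] [ChartedSpace (EuclideanSpace ℝ (Fin 2)) S] {g g' : S → F} {p : S}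
    (e : g =ᶠ[𝓝 p] g') : mvfderiv (𝓡 2) g p = mvfderiv (𝓡 2) g' p := by
  simp only [mvfderiv]
  rw [e.mfderiv_eq]
  rw [e.eq_of_nhds]

/-! ### Frame components of fields along a map -/

section AlongFrame

variable {M : Type*} [TopologicalSpace M] [ChartedSpace (EuclideanSpace ℝ (Fin 3)) M]
  [IsManifold (𝓡 3) ∞ M]
  {S : Type*} [TopologicalSpace S] [ChartedSpace (EuclideanSpace ℝ (Fin 2)) S]
  {cov : CovariantDerivative (𝓡 3) (EuclideanSpace ℝ (Fin 3)) (TangentSpace (𝓡 3) : M → Type _)}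
  {f : S → M} {p : S} {V V' : ∀ q : S, TangentSpace (𝓡 3) (f q)}

/-- The `i`-th component of a vector field along `f` in the standard local frame near `f p`. -/
def compAlong (f : S → M) (p : S) (V : ∀ q : S, TangentSpace (𝓡 3) (f q)) (i : Fin 3) (q : S) : ℝ :=
  coordAlong f p V q i

lemma eq_sum_compAlong (V : ∀ q : S, TangentSpace (𝓡 3) (f q)) {q : S}
    (hq : f q ∈ frameDomain (f p)) :
    V q = ∑ i, compAlong f p V i q • frameField (f p) i (f q) := by
  have h := constField_eq_sum hq (coordAlong f p V q)
  rw [coordAlong, constField_triv hq] at h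
  exact h

lemma mdifferentiableAt_compAlong {q : S} (hq : f q ∈ frameDomain (f p))
    (h : DiffAlongAt f V q) (i : Fin 3) :
    MDifferentiableAt (𝓡 2) 𝓘(ℝ, ℝ) (compAlong f p V i) q := by
  have h1 := ((trivializationAt (EuclideanSpace ℝ (Fin 3)) (TangentSpace (𝓡 3) : M → Type _)
    (f p)).mdifferentiableAt_totalSpace_iff (IM := 𝓡 2) (IB := 𝓡 3) _
      (x₀ := q) (by exact hq)).1 h
  exact (EuclideanSpace.proj (𝕜 := ℝ) i).mdifferentiableAt.comp q h1.2

lemma contMDiffAt_compAlong {q : S} (hq : f q ∈ frameDomain (f p))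
    (h : ContMDiffAt (𝓡 2) (𝓡 3).tangent ∞
      (fun q ↦ TotalSpace.mk' (EuclideanSpace ℝ (Fin 3)) (f q) (V q)) q) (i : Fin 3) :
    ContMDiffAt (𝓡 2) 𝓘(ℝ, ℝ) ∞ (compAlong f p V i) q := by
  have h1 := ((trivializationAt (EuclideanSpace ℝ (Fin 3)) (TangentSpace (𝓡 3) : M → Type _)
    (f p)).contMDiffAt_iff (n := ∞) (IM := 𝓡 2) (IB := 𝓡 3)
      (x₀ := q) (by exact hq)).1 h
  exact (EuclideanSpace.proj (𝕜 := ℝ) i).contMDiff.contMDiffAt.comp q h1.2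

/-- The covariant derivative along `f` in a local frame. -/
lemma hasCovAlong_frame {q : S} (hq : f q ∈ frameDomain (f p)) (h : DiffAlongAt f V q) :
    HasCovAlong cov f V q
      (∑ i, (compAlong f p V i q • (cov (frameField (f p) i) (f q) ∘L mfderiv (𝓡 2) (𝓡 3) f q) +
        (mvfderiv (𝓡 2) (compAlong f p V i) q).smulRight (frameField (f p) i (f q)))) := by
  -- The frame stays the one at `f p` while the point `q` moves, so that the resulting formula can
  -- be differentiated once more.
  refine HasCovAlong.congr (V := fun q ↦ ∑ i, compAlong f p V i q • frameField (f p) i (f q))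
    ?_ ?_
  · refine HasCovAlong.sum _ h.base fun i _ ↦ ?_
    exact (HasCovAlong.comp (Y := frameField (f p) i) h.base
      (diffFieldAt_constField hq _)).smul (mdifferentiableAt_compAlong hq h i)
  · filter_upwards [h.base.continuousAt.preimage_mem_nhds (frameDomain_mem_nhds hq)] with r hr
    exact eq_sum_compAlong V hr

end AlongFrame

/-! ### Metric compatibility along a map -/

section MetricCompatible

variable {M : Type*} [TopologicalSpace M] [ChartedSpace (EuclideanSpace ℝ (Fin 3)) M]
  [IsManifold (𝓡 3) ∞ M]
  [RiemannianBundle (fun x : M ↦ TangentSpace (𝓡 3) x)]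
  [IsContMDiffRiemannianBundle (𝓡 3) ∞ (EuclideanSpace ℝ (Fin 3))
      (fun x : M ↦ TangentSpace (𝓡 3) x)]
  {S : Type*} [TopologicalSpace S] [ChartedSpace (EuclideanSpace ℝ (Fin 2)) S]
  {cov : CovariantDerivative (𝓡 3) (EuclideanSpace ℝ (Fin 3)) (TangentSpace (𝓡 3) : M → Type _)}
  {f : S → M} {p : S} {V V' : ∀ q : S, TangentSpace (𝓡 3) (f q)}
  {A A' : TangentSpace (𝓡 2) p →L[ℝ] TangentSpace (𝓡 3) (f p)}

lemma mdifferentiableAt_inner_along (h : DiffAlongAt f V p) (h' : DiffAlongAt f V' p) :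
    MDifferentiableAt (𝓡 2) 𝓘(ℝ, ℝ) (fun q ↦ inner ℝ (V q) (V' q)) p :=
  MDifferentiableAt.inner_bundle (IB := 𝓡 3) h h'

/-- The product rule for the inner product of two vector fields along `f`, with prescribed covariant
derivatives `A` and `A'`. -/
def InnerRule (f : S → M) (V V' : ∀ q : S, TangentSpace (𝓡 3) (f q)) (p : S)
    (A A' : TangentSpace (𝓡 2) p →L[ℝ] TangentSpace (𝓡 3) (f p)) : Prop :=
  ∀ u, mvfderiv (𝓡 2) (fun q ↦ inner ℝ (V q) (V' q)) p u =
    inner ℝ (A u) (V' p) + inner ℝ (V p) (A' u)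

omit [IsManifold (𝓡 3) ∞ M] [IsContMDiffRiemannianBundle (𝓡 3) ∞ (EuclideanSpace ℝ (Fin 3))
      (fun x : M ↦ TangentSpace (𝓡 3) x)] in
lemma InnerRule.symm (h : InnerRule f V V' p A A') : InnerRule f V' V p A' A := by
  intro u
  have := h u
  simp only [real_inner_comm] at this ⊢
  rw [this, add_comm]

/-- The product rule survives linear combinations with function coefficients in the left slot. With
`InnerRule.symm` this holds in either slot, so the rule only has to be known for frame fields. -/
lemma InnerRule.sum_smul {W : Fin 3 → ∀ q : S, TangentSpace (𝓡 3) (f q)}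
    {B : Fin 3 → TangentSpace (𝓡 2) p →L[ℝ] TangentSpace (𝓡 3) (f p)} {g : Fin 3 → S → ℝ}
    (hg : ∀ i, MDifferentiableAt (𝓡 2) 𝓘(ℝ, ℝ) (g i) p)
    (hW : ∀ i, DiffAlongAt f (W i) p) (hV' : DiffAlongAt f V' p)
    (h : ∀ i, InnerRule f (W i) V' p (B i) A') :
    InnerRule f (fun q ↦ ∑ i, g i q • W i q) V' p
      (∑ i, (g i p • B i + (mvfderiv (𝓡 2) (g i) p).smulRight (W i p))) A' := by
  have hd : ∀ i, MDifferentiableAt (𝓡 2) 𝓘(ℝ, ℝ) (fun q ↦ inner ℝ (W i q) (V' q)) p :=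
    fun i ↦ mdifferentiableAt_inner_along (hW i) hV'
  have e0 : (fun q ↦ inner ℝ (∑ i, g i q • W i q) (V' q)) =
      (g 0 * fun q ↦ inner ℝ (W 0 q) (V' q)) + (g 1 * fun q ↦ inner ℝ (W 1 q) (V' q)) +
      (g 2 * fun q ↦ inner ℝ (W 2 q) (V' q)) := by
    funext q
    simp [Fin.sum_univ_three, inner_add_left, real_inner_smul_left]
  intro u
  rw [e0, mvfderiv_add (((hg 0).mul (hd 0)).add ((hg 1).mul (hd 1))) ((hg 2).mul (hd 2)),
    mvfderiv_add ((hg 0).mul (hd 0)) ((hg 1).mul (hd 1)), mvfderiv_mul (hg 0) (hd 0),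
    mvfderiv_mul (hg 1) (hd 1), mvfderiv_mul (hg 2) (hd 2)]
  have h0 := h 0 u
  have h1 := h 1 u
  have h2 := h 2 u
  simp only [Fin.sum_univ_three, inner_add_left, real_inner_smul_left, add_apply,
    ContinuousLinearMap.smulRight_apply, smul_apply, smul_eq_mul, h0, h1, h2]
  ring

lemma innerRule_comp (hcov : cov.IsMetricCompatible) {Y Y' : ∀ x : M, TangentSpace (𝓡 3) x}
    (hf : MDifferentiableAt (𝓡 2) (𝓡 3) f p)
    (hY : DiffFieldAt Y (f p)) (hY' : DiffFieldAt Y' (f p)) :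
    InnerRule f (fun q ↦ Y (f q)) (fun q ↦ Y' (f q)) p
      (cov Y (f p) ∘L mfderiv (𝓡 2) (𝓡 3) f p) (cov Y' (f p) ∘L mfderiv (𝓡 2) (𝓡 3) f p) := by
  intro u
  -- Metric compatibility is stated for a vector field as direction; any extension of `df u` serves.
  have h := hcov.mvfderiv_inner_eq (x := f p)
    (FiberBundle.extend (EuclideanSpace ℝ (Fin 3)) (mfderiv (𝓡 2) (𝓡 3) f p u)) hY hY'
  simp only [FiberBundle.extend_apply_self] at h
  have h2 := mvfderiv_comp_apply (I := 𝓡 3) (I' := 𝓡 2) (f := f)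
    (g := fun x ↦ inner ℝ (Y x) (Y' x)) p
    (MDifferentiableAt.inner_bundle (IB := 𝓡 3) (b := fun x : M ↦ x) hY hY') hf u
  exact h2.trans h

/-- Metric compatibility for vector fields along `f`. -/
lemma innerRule_covAlong (hcov : cov.IsMetricCompatible) (h : DiffAlongAt f V p)
    (h' : DiffAlongAt f V' p) :
    InnerRule f V V' p (covAlong cov f V p) (covAlong cov f V' p) := by
  have hp : f p ∈ frameDomain (f p) := mem_frameDomain_self _
  have hK : ∀ i, DiffFieldAt (frameField (f p) i) (f p) := fun i ↦ diffFieldAt_constField hp _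
  have hK' : ∀ i, DiffAlongAt f (fun q ↦ frameField (f p) i (f q)) p :=
    fun i ↦ MDifferentiableAt.comp p (hK i) h.base
  have hsum : DiffAlongAt f (fun q ↦ ∑ i, compAlong f p V i q • frameField (f p) i (f q)) p :=
    h.congr (by
      filter_upwards [eventually_mem_baseSet h.base.continuousAt] with q hq
      exact (eq_sum_compAlong V hq).symm)
  rw [(hasCovAlong_frame (cov := cov) hp h).covAlong_eq,
    (hasCovAlong_frame (cov := cov) hp h').covAlong_eq]
  -- The inner sum expands `V` against a fixed frame field; after exchanging the slots the outer sum
  -- expands `V'`.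
  have key := InnerRule.sum_smul (fun i ↦ mdifferentiableAt_compAlong hp h' i) hK' hsum fun i ↦
    (InnerRule.sum_smul (fun j ↦ mdifferentiableAt_compAlong hp h j) hK' (hK' i) fun j ↦
      innerRule_comp hcov h.base (hK j) (hK i)).symm
  intro u
  have k := key.symm u
  rw [← eq_sum_compAlong V hp, ← eq_sum_compAlong V' hp] at k
  rw [← k]
  have e : (fun q ↦ inner ℝ (V q) (V' q)) =ᶠ[𝓝 p] fun q ↦
      inner ℝ (∑ i, compAlong f p V i q • frameField (f p) i (f q))
        (∑ i, compAlong f p V' i q • frameField (f p) i (f q)) := by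
    filter_upwards [eventually_mem_baseSet h.base.continuousAt] with q hq
    rw [← eq_sum_compAlong V hq, ← eq_sum_compAlong V' hq]
  rw [mvfderiv_congr e]

end MetricCompatible

/-! ### Ambient fields: covariant derivatives, coordinate fields and their brackets -/

section CovOfFields

variable {M : Type*} [TopologicalSpace M] [ChartedSpace (EuclideanSpace ℝ (Fin 3)) M]
  [IsManifold (𝓡 3) ∞ M]
  (cov : CovariantDerivative (𝓡 3) (EuclideanSpace ℝ (Fin 3)) (TangentSpace (𝓡 3) : M → Type _))

variable {cov} in
lemma cov_congr {Y Y' : ∀ x : M, TangentSpace (𝓡 3) x} {x : M} (h : DiffFieldAt Y x)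
    (e : ∀ᶠ y in 𝓝 x, Y' y = Y y) : cov Y' x = cov Y x := by
  have h' : DiffFieldAt Y' x := by
    refine MDifferentiableAt.congr_of_eventuallyEq h ?_
    filter_upwards [e] with q hq
    rw [hq]
  exact cov.isCovariantDerivativeOnUniv.congr_of_eventuallyEq h' h Filter.univ_mem e

lemma cov_sum_smul {ι : Type*} (s : Finset ι) (c : ι → ℝ) {Y : ι → ∀ x : M, TangentSpace (𝓡 3) x}
    {x : M} (hY : ∀ i, DiffFieldAt (Y i) x) :
    DiffFieldAt (fun y ↦ ∑ i ∈ s, c i • Y i y) x ∧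
      cov (fun y ↦ ∑ i ∈ s, c i • Y i y) x = ∑ i ∈ s, c i • cov (Y i) x := by
  classical
  induction s using Finset.induction_on with
  | empty =>
    have h0 : cov 0 = 0 := cov.zero
    have : (fun y : M ↦ (0 : TangentSpace (𝓡 3) y)) = 0 := rfl
    simp only [Finset.sum_empty, this, h0]
    exact ⟨mdifferentiableAt_zeroSection .., rfl⟩
  | insert a s ha ih =>
    simp only [Finset.sum_insert ha]
    have h1 : DiffFieldAt (c a • Y a) x := mdifferentiableAt_const.smul_section (hY a)
    refine ⟨mdifferentiableAt_add_section h1 ih.1, ?_⟩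
    rw [← ih.2, ← cov.isCovariantDerivativeOnUniv.smul_const (c a) (hY a)]
    exact cov.isCovariantDerivativeOnUniv.add h1 ih.1

lemma cov_constField {x₀ y : M} (hy : y ∈ frameDomain x₀) (a : EuclideanSpace ℝ (Fin 3)) :
    cov (constField x₀ a) y = ∑ i, a i • cov (frameField x₀ i) y := by
  have h := cov_sum_smul cov (x := y) Finset.univ (fun i ↦ a i) (Y := fun i ↦ frameField x₀ i)
    fun i ↦ diffFieldAt_constField hy _
  rw [← h.2]
  refine cov_congr h.1 ?_
  filter_upwards [frameDomain_mem_nhds hy] with z hz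
  exact constField_eq_sum hz a

variable {H E : Type*} [NormedAddCommGroup E] [NormedSpace ℝ E] [CompleteSpace E]
  [TopologicalSpace H] {I : ModelWithCorners ℝ E H} {N : Type*} [TopologicalSpace N]
  [ChartedSpace H N] {F : Type*} [NormedAddCommGroup F] [NormedSpace ℝ F]

/-- The constant vector field of a normed space. -/
def modelField (a : F) (y : F) : TangentSpace 𝓘(ℝ, F) y := a

/-- The coordinate vector field of the coordinate system `φ` in the direction `a`. -/
def coordField (I : ModelWithCorners ℝ E H) {N : Type*} [TopologicalSpace N]
    [ChartedSpace H N] (φ : N → F) (a : F) : ∀ x : N, TangentSpace I x :=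
  VectorField.mpullback I 𝓘(ℝ, F) φ (modelField a)

omit [CompleteSpace E] in
lemma mfderiv_coordField {φ : N → F} {x : N} (h : (mfderiv I 𝓘(ℝ, F) φ x).IsInvertible) (a : F) :
    mfderiv I 𝓘(ℝ, F) φ x (coordField I φ a x) = modelField a (φ x) := by
  obtain ⟨e, he⟩ := h
  rw [coordField, VectorField.mpullback_apply, ← he]
  simp

omit [CompleteSpace E] in
lemma eq_coordField {φ : N → F} {x : N} (h : (mfderiv I 𝓘(ℝ, F) φ x).IsInvertible) {a : F}
    {v : TangentSpace I x} (hv : mfderiv I 𝓘(ℝ, F) φ x v = modelField a (φ x)) :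
    v = coordField I φ a x := by
  obtain ⟨e, he⟩ := h
  rw [coordField, VectorField.mpullback_apply, ← hv, ← he]
  simp

lemma mdifferentiableAt_modelField (a y : F) : MDifferentiableAt 𝓘(ℝ, F) 𝓘(ℝ, F).tangent
    (fun y : F ↦ TotalSpace.mk' F y (modelField a y)) y := by
  have h := mdifferentiableAt_section 𝓘(ℝ, F) (F := F) (E := (TangentSpace 𝓘(ℝ, F) : F → Type _))
    (modelField a) (b₀ := y)
  refine h.2 ?_
  simp only [modelField, mfld_simps]
  exact mdifferentiableAt_const

/-- The Lie bracket is natural under pullback, and constant fields of a normed space commute. -/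
lemma mlieBracket_coordField [CompleteSpace F] [IsManifold I ∞ N]
    {φ : N → F} {x : N} (hφ : ContMDiffAt I 𝓘(ℝ, F) ∞ φ x) (a b : F) :
    VectorField.mlieBracket I (coordField I φ a) (coordField I φ b) x = 0 := by
  have : IsManifold I (minSmoothness ℝ 3) N := by
    simp only [minSmoothness_of_isRCLikeNormedField]
    exact IsManifold.of_le (n := ∞) (by decide)
  rw [coordField, coordField, ← VectorField.mpullback_mlieBracket (n := ∞)
    (mdifferentiableAt_modelField a _) (mdifferentiableAt_modelField b _) hφ (by
    simp only [minSmoothness_of_isRCLikeNormedField]; decide)]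
  rw [VectorField.mpullback_apply]
  have h0 : VectorField.mlieBracket 𝓘(ℝ, F) (modelField a) (modelField b) (φ x) = 0 := by
    rw [← VectorField.mlieBracketWithin_univ]
    rw [VectorField.mlieBracketWithin_eq_lieBracketWithin]
    simp only [VectorField.lieBracketWithin]
    have : ∀ a : F, fderivWithin ℝ (modelField a : F → F) univ (φ x) = 0 := fun a ↦ by
      change fderivWithin ℝ (fun _ : F ↦ a) univ (φ x) = 0
      simp
    erw [this, this]
    exact sub_zero (0 : F)
  rw [h0, map_zero]

/-- The trivialization of the tangent bundle at `x₀` is the differential of the chart at `x₀`.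
Constant components in it therefore mean a coordinate field, which is why the frame fields commute.
-/
lemma constField_eq_coordField {x₀ y : M} (hy : y ∈ frameDomain x₀)
    (a : EuclideanSpace ℝ (Fin 3)) :
    constField x₀ a y = coordField (𝓡 3) (extChartAt (𝓡 3) x₀) a y := by
  refine eq_coordField (isInvertible_mfderiv_extChartAt (by simpa using hy)) ?_
  rw [constField_eq_symmL x₀ a hy,
    ← TangentBundle.continuousLinearMapAt_trivializationAt (I := 𝓡 3) hy]
  exact Trivialization.continuousLinearMapAt_symmL _ hy a

lemma mlieBracket_constField (x₀ : M) (a b : EuclideanSpace ℝ (Fin 3)) :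
    VectorField.mlieBracket (𝓡 3) (constField x₀ a) (constField x₀ b) x₀ = 0 := by
  have e : ∀ a, constField x₀ a =ᶠ[𝓝 x₀] coordField (𝓡 3) (extChartAt (𝓡 3) x₀) a := by
    intro a
    filter_upwards [frameDomain_mem_nhds (mem_frameDomain_self x₀)] with y hy
    exact constField_eq_coordField hy a
  rw [(e a).mlieBracket_vectorField_eq (e b)]
  exact mlieBracket_coordField (contMDiffAt_extChartAt (n := ∞)) a b

variable [T2Space M] [cov.ContMDiffCovariantDerivative ∞]

/-- Smoothness of the connection is applied to a global smooth field, but the frame fields are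
smooth only on the chart domain. A bump function equal to 1 near `x₀` cuts them off, and the
connection is local. -/
lemma diffFieldAt_cov_frameField (x₀ : M) (i j : Fin 3) :
    DiffFieldAt (fun y ↦ cov (frameField x₀ i) y (frameField x₀ j y)) x₀ := by
  let ψ : SmoothBumpFunction (𝓡 3) x₀ := Classical.arbitrary _
  let Y : ∀ y : M, TangentSpace (𝓡 3) y := fun y ↦ ψ y • frameField x₀ i y
  have hY : ContMDiff (𝓡 3) (𝓡 3).tangent ∞
      (fun x ↦ TotalSpace.mk' (EuclideanSpace ℝ (Fin 3)) x (Y x)) := by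
    intro y
    by_cases hy : y ∈ tsupport ψ
    · exact ψ.contMDiffAt.smul_section
        (contMDiffAt_constField (ψ.tsupport_subset_chartAt_source hy) _)
    · have h0 : ContMDiffAt (𝓡 3) (𝓡 3).tangent ∞ (fun x : M ↦
          TotalSpace.mk' (EuclideanSpace ℝ (Fin 3)) x (0 : TangentSpace (𝓡 3) x)) y :=
        (contMDiff_zeroSection ℝ (TangentSpace (𝓡 3) : M → Type _)).contMDiffAt
      refine h0.congr_of_eventuallyEq ?_
      filter_upwards [(isClosed_tsupport ψ).isOpen_compl.mem_nhds hy] with z hz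
      simp only [Y, image_eq_zero_of_notMem_tsupport hz, zero_smul]
  have h1 := (CovariantDerivative.ContMDiffCovariantDerivative.contMDiff (cov := cov)
    (k := ∞)).contMDiff (σ := Y) (contMDiffOn_univ.2 (by exact hY))
  have h2 := (contMDiffOn_univ.1 h1 x₀).mdifferentiableAt (by simp)
  have h3 := MDifferentiableAt.clm_bundle_apply h2
    (diffFieldAt_constField (mem_frameDomain_self x₀) (EuclideanSpace.single j (1 : ℝ)))
  refine MDifferentiableAt.congr_of_eventuallyEq h3 ?_
  -- Equality of the two fields at `y` alone would not identify their covariant derivatives at `y`: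
  -- they have to agree near `y`, for all `y` near `x₀`.
  have e1 : ∀ᶠ y in 𝓝 x₀, ∀ᶠ z in 𝓝 y, Y z = frameField x₀ i z := by
    refine eventually_eventually_nhds.2 ?_
    filter_upwards [ψ.eventuallyEq_one] with z hz
    simp [Y, hz]
  filter_upwards [e1, frameDomain_mem_nhds (mem_frameDomain_self x₀)] with y hy hy'
  have h4 : cov Y y = cov (frameField x₀ i) y := cov_congr (diffFieldAt_constField hy' _) hy
  rw [h4]
  rfl

end CovOfFields

/-! ### Commuting fields on the surface and the ambient torsion -/

section CommutingFields

variable {M : Type*} [TopologicalSpace M] [ChartedSpace (EuclideanSpace ℝ (Fin 3)) M]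
  [IsManifold (𝓡 3) ∞ M]
  {S : Type*} [TopologicalSpace S] [ChartedSpace (EuclideanSpace ℝ (Fin 2)) S]
  [IsManifold (𝓡 2) ∞ S]
  {cov : CovariantDerivative (𝓡 3) (EuclideanSpace ℝ (Fin 3)) (TangentSpace (𝓡 3) : M → Type _)}
  {f : S → M} {p : S} {X Y : ∀ q : S, TangentSpace (𝓡 2) q}

/-- Differentiability of a vector field of a surface at a point. -/
abbrev DiffTangentAt (X : ∀ q : S, TangentSpace (𝓡 2) q) (p : S) : Prop :=
  MDifferentiableAt (𝓡 2) (𝓡 2).tangent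
    (fun q ↦ TotalSpace.mk' (EuclideanSpace ℝ (Fin 2)) q (X q)) p

/-- The vector fields `X` and `Y` are differentiable at `p` and commute there as derivations. -/
structure CommuteAt (X Y : ∀ q : S, TangentSpace (𝓡 2) q) (p : S) : Prop where
  diff_left : DiffTangentAt X p
  diff_right : DiffTangentAt Y p
  deriv_left : ∀ h : S → ℝ, ContMDiffAt (𝓡 2) 𝓘(ℝ, ℝ) ∞ h p →
    MDifferentiableAt (𝓡 2) 𝓘(ℝ, ℝ) (fun q ↦ mvfderiv (𝓡 2) h q (X q)) p
  deriv_right : ∀ h : S → ℝ, ContMDiffAt (𝓡 2) 𝓘(ℝ, ℝ) ∞ h p →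
    MDifferentiableAt (𝓡 2) 𝓘(ℝ, ℝ) (fun q ↦ mvfderiv (𝓡 2) h q (Y q)) p
  comm : ∀ h : S → ℝ, ContMDiffAt (𝓡 2) 𝓘(ℝ, ℝ) ∞ h p →
    mvfderiv (𝓡 2) (fun q ↦ mvfderiv (𝓡 2) h q (Y q)) p (X p) =
      mvfderiv (𝓡 2) (fun q ↦ mvfderiv (𝓡 2) h q (X q)) p (Y p)

/-- The image of a tangent vector field of a surface under the differential of `f`. -/
abbrev pushAlong (f : S → M) (X : ∀ q : S, TangentSpace (𝓡 2) q) (q : S) :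
    TangentSpace (𝓡 3) (f q) :=
  mfderiv (𝓡 2) (𝓡 3) f q (X q)

/-- The `i`-th component of `f` in the chart at `f p`. -/
def compMap (f : S → M) (p : S) (i : Fin 3) (q : S) : ℝ := extChartAt (𝓡 3) (f p) (f q) i

lemma contMDiffAt_compMap (hf : ContMDiff (𝓡 2) (𝓡 3) ∞ f) {q : S} (hq : f q ∈ frameDomain (f p))
    (i : Fin 3) :
    ContMDiffAt (𝓡 2) 𝓘(ℝ, ℝ) ∞ (compMap f p i) q := by
  have h1 : ContMDiffAt (𝓡 3) 𝓘(ℝ, EuclideanSpace ℝ (Fin 3)) ∞ (extChartAt (𝓡 3) (f p)) (f q) :=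
    contMDiffAt_extChartAt' (by simpa using hq)
  exact (EuclideanSpace.proj (𝕜 := ℝ) i).contMDiff.contMDiffAt.comp q (h1.comp q hf.contMDiffAt)

/-- The frame is a coordinate frame, so the components of `df X` are the derivatives along `X` of
the coordinates of `f`. Commutation of `X` and `Y` on functions thus passes to the pushed-forward
fields. -/
lemma compAlong_pushAlong (hf : ContMDiff (𝓡 2) (𝓡 3) ∞ f) {q : S}
    (hq : f q ∈ frameDomain (f p)) (X : ∀ q : S, TangentSpace (𝓡 2) q) (i : Fin 3) :
    compAlong f p (pushAlong f X) i q = mvfderiv (𝓡 2) (compMap f p i) q (X q) := by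
  have h1 : MDifferentiableAt (𝓡 3) 𝓘(ℝ, EuclideanSpace ℝ (Fin 3)) (extChartAt (𝓡 3) (f p)) (f q) :=
    mdifferentiableAt_extChartAt hq
  have h2 := TangentBundle.continuousLinearMapAt_trivializationAt (I := 𝓡 3) hq
  have h3 : coordAlong f p (pushAlong f X) q = (trivializationAt (EuclideanSpace ℝ (Fin 3))
      (TangentSpace (𝓡 3) : M → Type _) (f p)).continuousLinearMapAt ℝ (f q) (pushAlong f X q) := by
    rw [Trivialization.continuousLinearMapAt_apply, Trivialization.linearMapAt_apply, if_pos hq]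
    rfl
  have hfq : MDifferentiableAt (𝓡 2) (𝓡 3) f q := hf.mdifferentiable (by simp) q
  let pr : EuclideanSpace ℝ (Fin 3) →L[ℝ] ℝ := EuclideanSpace.proj (𝕜 := ℝ) i
  have h4 := mfderiv_comp_apply q
    (pr.mdifferentiableAt (x := extChartAt (𝓡 3) (f p) (f q))) (h1.comp q hfq) (X q)
  have h5 := mfderiv_comp_apply q h1 hfq (X q)
  have h6 : mvfderiv (𝓡 2) (compMap f p i) q (X q) =
      pr (mfderiv (𝓡 3) 𝓘(ℝ, EuclideanSpace ℝ (Fin 3)) (extChartAt (𝓡 3) (f p)) (f q)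
        (mfderiv (𝓡 2) (𝓡 3) f q (X q))) := by
    rw [← h5]
    refine Eq.trans h4 ?_
    rw [pr.mfderiv_eq]
    rfl
  rw [h6, ← h2, compAlong, h3]
  rfl

variable (hf : ContMDiff (𝓡 2) (𝓡 3) ∞ f)
include hf

lemma eventually_mem_frameDomain : ∀ᶠ q in 𝓝 p, f q ∈ frameDomain (f p) :=
  eventually_mem_baseSet hf.continuous.continuousAt

lemma CommuteAt.mvfderiv_compAlong (h : CommuteAt X Y p) (i : Fin 3) :
    mvfderiv (𝓡 2) (compAlong f p (pushAlong f Y) i) p (X p) =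
      mvfderiv (𝓡 2) (compAlong f p (pushAlong f X) i) p (Y p) := by
  have e : ∀ X : ∀ q : S, TangentSpace (𝓡 2) q, compAlong f p (pushAlong f X) i =ᶠ[𝓝 p]
      fun q ↦ mvfderiv (𝓡 2) (compMap f p i) q (X q) := by
    intro X
    filter_upwards [eventually_mem_frameDomain hf] with q hq
    exact compAlong_pushAlong hf hq X i
  rw [mvfderiv_congr (e X), mvfderiv_congr (e Y)]
  exact h.comm _ (contMDiffAt_compMap hf (mem_frameDomain_self _) i)

/-- The torsion of the ambient connection in terms of the covariant derivative along `f`. -/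
lemma covAlong_sub_eq_torsion (h : CommuteAt X Y p) :
    covAlong cov f (pushAlong f Y) p (X p) - covAlong cov f (pushAlong f X) p (Y p) =
      cov.torsion (f p) (pushAlong f X p) (pushAlong f Y p) := by
  have hp := mem_frameDomain_self (f p)
  rw [(hasCovAlong_frame (cov := cov) hp (diffAlong_mfderiv hf h.diff_left)).covAlong_eq,
    (hasCovAlong_frame (cov := cov) hp (diffAlong_mfderiv hf h.diff_right)).covAlong_eq,
    CovariantDerivative.torsion_apply_eq_extend]
  simp only [FiberBundle.extend_apply_self]
  rw [extend_eq_constField, extend_eq_constField, mlieBracket_constField, cov_constField cov hp,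
    cov_constField cov hp]
  -- The derivatives of the components cancel by commutation. What is left is the torsion on fields
  -- of constant components, whose bracket vanishes.
  have hc := h.mvfderiv_compAlong hf
  simp only [Fin.sum_univ_three, add_apply, smul_apply,
    ContinuousLinearMap.smulRight_apply, ContinuousLinearMap.comp_apply, hc, sub_zero]
  simp only [compAlong, coordAlong]
  abel

end CommutingFields

/-! ### Second covariant derivatives and the curvature -/

section SecondDerivatives

variable {M : Type*} [TopologicalSpace M] [T2Space M] [ChartedSpace (EuclideanSpace ℝ (Fin 3)) M]
  [IsManifold (𝓡 3) ∞ M]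
  {S : Type*} [TopologicalSpace S] [ChartedSpace (EuclideanSpace ℝ (Fin 2)) S]
  [IsManifold (𝓡 2) ∞ S]
  {cov : CovariantDerivative (𝓡 3) (EuclideanSpace ℝ (Fin 3)) (TangentSpace (𝓡 3) : M → Type _)}
  [cov.ContMDiffCovariantDerivative ∞]
  {f : S → M} {p : S} {X Y Z : ∀ q : S, TangentSpace (𝓡 2) q}
  {V : ∀ q : S, TangentSpace (𝓡 3) (f q)}

/-- The covariant derivative of the `i`-th field of the local frame near `x₀` in the direction of
the `j`-th one. -/
def frameCov (cov : CovariantDerivative (𝓡 3) (EuclideanSpace ℝ (Fin 3))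
    (TangentSpace (𝓡 3) : M → Type _)) (x₀ : M) (i j : Fin 3) (y : M) : TangentSpace (𝓡 3) y :=
  cov (frameField x₀ i) y (frameField x₀ j y)

/-- The second covariant derivative of a vector field along `f` in a local frame. -/
lemma hasCovAlong_covAlong (hf : ContMDiff (𝓡 2) (𝓡 3) ∞ f)
    (hV : ContMDiff (𝓡 2) (𝓡 3).tangent ∞
      (fun q ↦ TotalSpace.mk' (EuclideanSpace ℝ (Fin 3)) (f q) (V q)))
    (hZ : DiffTangentAt Z p) (hZ' : ∀ h : S → ℝ, ContMDiffAt (𝓡 2) 𝓘(ℝ, ℝ) ∞ h p →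
      MDifferentiableAt (𝓡 2) 𝓘(ℝ, ℝ) (fun q ↦ mvfderiv (𝓡 2) h q (Z q)) p) :
    HasCovAlong cov f (fun q ↦ covAlong cov f V q (Z q)) p
      (∑ i, (compAlong f p V i p •
          (∑ j, (compAlong f p (pushAlong f Z) j p •
            (cov (frameCov cov (f p) i j) (f p) ∘L mfderiv (𝓡 2) (𝓡 3) f p) +
              (mvfderiv (𝓡 2) (compAlong f p (pushAlong f Z) j) p).smulRight
                (frameCov cov (f p) i j (f p)))) +
          (mvfderiv (𝓡 2) (compAlong f p V i) p).smulRight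
            (cov (frameField (f p) i) (f p) (pushAlong f Z p)) +
          (mvfderiv (𝓡 2) (compAlong f p V i) p (Z p) •
            (cov (frameField (f p) i) (f p) ∘L mfderiv (𝓡 2) (𝓡 3) f p) +
          (mvfderiv (𝓡 2) (fun q ↦ mvfderiv (𝓡 2) (compAlong f p V i) q (Z q)) p).smulRight
            (frameField (f p) i (f p))))) := by
  have hp := mem_frameDomain_self (f p)
  have hfp : MDifferentiableAt (𝓡 2) (𝓡 3) f p := hf.mdifferentiable (by simp) p
  have expand : ∀ q, f q ∈ frameDomain (f p) → ∀ i,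
      cov (frameField (f p) i) (f q) (pushAlong f Z q) =
        ∑ j, compAlong f p (pushAlong f Z) j q • frameCov cov (f p) i j (f q) := by
    intro q hq i
    conv_lhs => rw [eq_sum_compAlong (pushAlong f Z) hq]
    rw [map_sum]
    simp only [map_smul, frameCov]
  -- Near `p` the first derivative is again a combination, with differentiable coefficients, of
  -- restrictions of ambient fields: the frame fields and their mutual covariant derivatives. The
  -- sum and product rules apply to it.
  refine HasCovAlong.congr (V := fun q ↦ ∑ i, (compAlong f p V i q •
      (∑ j, compAlong f p (pushAlong f Z) j q • frameCov cov (f p) i j (f q)) +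
      mvfderiv (𝓡 2) (compAlong f p V i) q (Z q) • frameField (f p) i (f q))) ?_ ?_
  · refine HasCovAlong.sum _ hfp fun i _ ↦ HasCovAlong.add ?_ ?_
    · rw [expand p hp i]
      refine HasCovAlong.smul (HasCovAlong.sum _ hfp fun j _ ↦ ?_)
        ((contMDiffAt_compAlong hp hV.contMDiffAt i).mdifferentiableAt (by simp))
      exact (HasCovAlong.comp (Y := frameCov cov (f p) i j) hfp
        (diffFieldAt_cov_frameField cov (f p) i j)).smul
          (mdifferentiableAt_compAlong hp (diffAlong_mfderiv hf hZ) j)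
    · exact (HasCovAlong.comp (Y := frameField (f p) i) hfp (diffFieldAt_constField hp _)).smul
        (hZ' _ (contMDiffAt_compAlong hp hV.contMDiffAt i))
  · filter_upwards [eventually_mem_frameDomain hf] with q hq
    have hd : DiffAlongAt f V q := hV.mdifferentiable (by simp) q
    rw [(hasCovAlong_frame (cov := cov) hq hd).covAlong_eq]
    simp only [← expand q hq, sum_apply, add_apply, smul_apply,
      ContinuousLinearMap.smulRight_apply, ContinuousLinearMap.comp_apply]

/-- On extensions with constant components the bracket term vanishes and no coefficient is
differentiated, so only the derivatives of `frameCov` survive. -/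
lemma curvature_eq_sum (x : M) (u v w : TangentSpace (𝓡 3) x) (a b c : EuclideanSpace ℝ (Fin 3))
    (ha : constField x a x = u) (hb : constField x b x = v) (hc : constField x c x = w) :
    curvature cov x u v w = ∑ i, c i • (∑ j, b j • cov (frameCov cov x i j) x u -
      ∑ j, a j • cov (frameCov cov x i j) x v) := by
  have hx := mem_frameDomain_self x
  have key : ∀ b, cov (fun y ↦ cov (constField x c) y (constField x b y)) x =
      ∑ i, c i • ∑ j, b j • cov (frameCov cov x i j) x := by
    intro b
    have hG : ∀ i j, DiffFieldAt (frameCov cov x i j) x := fun i j ↦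
      diffFieldAt_cov_frameField cov x i j
    have h1 := fun i ↦ cov_sum_smul cov Finset.univ (fun j ↦ b j)
      (Y := fun j ↦ frameCov cov x i j) (x := x) fun j ↦ hG i j
    have h2 := cov_sum_smul cov Finset.univ (fun i ↦ c i)
      (Y := fun i y ↦ ∑ j, b j • frameCov cov x i j y) (x := x) fun i ↦ (h1 i).1
    simp only [(h1 _).2] at h2
    rw [← h2.2]
    refine cov_congr h2.1 ?_
    filter_upwards [frameDomain_mem_nhds hx] with y hy
    rw [cov_constField cov hy, constField_eq_sum hy b]
    simp only [sum_apply, smul_apply, map_sum, map_smul, frameCov, Finset.smul_sum]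
    rw [Finset.sum_comm]
    simp only [smul_comm (b _)]
  have e : ∀ (v : TangentSpace (𝓡 3) x) a, constField x a x = v →
      FiberBundle.extend (EuclideanSpace ℝ (Fin 3)) v = constField x a := by
    intro v a h
    rw [extend_eq_constField, ← h, triv_constField x a hx]
  rw [curvature, curvatureField, e u a ha, e v b hb, e w c hc, mlieBracket_constField, key, key,
    ha, hb]
  simp only [map_zero, sub_zero, sum_apply, smul_apply, smul_sub,
    Finset.sum_sub_distrib]

/-- The curvature of the ambient connection as the commutator of the covariant derivatives
along `f`. -/
lemma covAlong_covAlong_sub (hf : ContMDiff (𝓡 2) (𝓡 3) ∞ f)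
    (hV : ContMDiff (𝓡 2) (𝓡 3).tangent ∞
      (fun q ↦ TotalSpace.mk' (EuclideanSpace ℝ (Fin 3)) (f q) (V q)))
    (h : CommuteAt X Y p) :
    covAlong cov f (fun q ↦ covAlong cov f V q (Y q)) p (X p) -
      covAlong cov f (fun q ↦ covAlong cov f V q (X q)) p (Y p) =
      curvature cov (f p) (pushAlong f X p) (pushAlong f Y p) (V p) := by
  have hp := mem_frameDomain_self (f p)
  have hc := h.mvfderiv_compAlong hf
  have hc' := fun i ↦ h.comm _ (contMDiffAt_compAlong hp hV.contMDiffAt i)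
  rw [(hasCovAlong_covAlong (cov := cov) hf hV h.diff_right h.deriv_right).covAlong_eq,
    (hasCovAlong_covAlong (cov := cov) hf hV h.diff_left h.deriv_left).covAlong_eq,
    curvature_eq_sum (f p) _ _ _ (coordAlong f p (pushAlong f X) p)
      (coordAlong f p (pushAlong f Y) p) (coordAlong f p V p) (constField_triv hp _)
      (constField_triv hp _) (constField_triv hp _)]
  -- Second derivatives of the components of `V` cancel by `hc'`, first derivatives of those of `df
  -- X` and `df Y` by `hc`. The mixed terms dVⁱ(X) ∇_Y Eᵢ + dVⁱ(Y) ∇_X Eᵢ are symmetric in `X` and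
  -- `Y`.
  simp only [sum_apply, add_apply, smul_apply, hc, hc',
    ContinuousLinearMap.smulRight_apply, ContinuousLinearMap.comp_apply, Finset.sum_add_distrib,
    smul_add, smul_sub, Finset.sum_sub_distrib, compAlong]
  abel

end SecondDerivatives

/-! ### Coordinate vector fields of a complex chart -/

namespace IsComplexChart

variable {S : Type*} [TopologicalSpace S] [ChartedSpace (EuclideanSpace ℝ (Fin 2)) S]
  [IsManifold (𝓡 2) ∞ S]
  {J : ∀ p : S, TangentSpace (𝓡 2) p →ₗ[ℝ] TangentSpace (𝓡 2) p}
  {z : OpenPartialHomeomorph S ℂ} (hz : IsComplexChart J z) {q : S} {ζ : ℂ}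
include hz

lemma contMDiffAt (hq : q ∈ z.source) : ContMDiffAt (𝓡 2) 𝓘(ℝ, ℂ) ∞ z q :=
  hz.smooth.contMDiffAt (z.open_source.mem_nhds hq)

lemma contMDiffAt_symm (hζ : ζ ∈ z.target) : ContMDiffAt 𝓘(ℝ, ℂ) (𝓡 2) ∞ z.symm ζ :=
  hz.smooth_symm.contMDiffAt (z.open_target.mem_nhds hζ)

lemma mdifferentiableAt (hq : q ∈ z.source) : MDifferentiableAt (𝓡 2) 𝓘(ℝ, ℂ) z q :=
  (hz.contMDiffAt hq).mdifferentiableAt (by simp)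

lemma mdifferentiableAt_symm (hζ : ζ ∈ z.target) : MDifferentiableAt 𝓘(ℝ, ℂ) (𝓡 2) z.symm ζ :=
  (hz.contMDiffAt_symm hζ).mdifferentiableAt (by simp)

lemma isInvertible (hq : q ∈ z.source) : (mfderiv (𝓡 2) 𝓘(ℝ, ℂ) z q).IsInvertible := by
  have hm : z.MDifferentiable (𝓡 2) 𝓘(ℝ, ℂ) :=
    ⟨hz.smooth.mdifferentiableOn (by simp), hz.smooth_symm.mdifferentiableOn (by simp)⟩
  exact ⟨hm.mfderiv hq, rfl⟩

lemma mvfderiv_coordField (hq : q ∈ z.source) (w : ℂ) :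
    mvfderiv (𝓡 2) z q (coordField (𝓡 2) z w q) = w :=
  mfderiv_coordField (hz.isInvertible hq) w

lemma eq_coordField_of_mvfderiv (hq : q ∈ z.source) {w : ℂ} {v : TangentSpace (𝓡 2) q}
    (hv : mvfderiv (𝓡 2) z q v = w) : v = coordField (𝓡 2) z w q :=
  eq_coordField (hz.isInvertible hq) hv

lemma coordField_mvfderiv (hq : q ∈ z.source) (v : TangentSpace (𝓡 2) q) :
    coordField (𝓡 2) z (mvfderiv (𝓡 2) z q v) q = v :=
  (hz.eq_coordField_of_mvfderiv hq rfl).symm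

lemma coordField_eq (hq : q ∈ z.source) (w : ℂ) : coordField (𝓡 2) z w q =
    w.re • coordField (𝓡 2) z 1 q + w.im • coordField (𝓡 2) z Complex.I q := by
  refine (hz.eq_coordField_of_mvfderiv hq ?_).symm
  rw [map_add, map_smul, map_smul, hz.mvfderiv_coordField hq, hz.mvfderiv_coordField hq]
  simp

lemma J_coordField (hq : q ∈ z.source) (w : ℂ) :
    J q (coordField (𝓡 2) z w q) = coordField (𝓡 2) z (Complex.I * w) q := by
  refine hz.eq_coordField_of_mvfderiv hq ?_
  rw [hz.map_J q hq, hz.mvfderiv_coordField hq]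

lemma J_coordField_one (hq : q ∈ z.source) :
    J q (coordField (𝓡 2) z 1 q) = coordField (𝓡 2) z Complex.I q := by
  rw [hz.J_coordField hq, mul_one]

lemma J_coordField_I (hq : q ∈ z.source) :
    J q (coordField (𝓡 2) z Complex.I q) = -coordField (𝓡 2) z 1 q := by
  rw [hz.J_coordField hq, hz.coordField_eq hq]
  simp

/-- Links `wirtinger`, defined through the inverse chart, to coordinate fields, defined by pullback
along the chart. -/
lemma mfderiv_symm (hζ : ζ ∈ z.target) (w : ℂ) :
    mfderiv 𝓘(ℝ, ℂ) (𝓡 2) z.symm ζ w = coordField (𝓡 2) z w (z.symm ζ) := by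
  refine eq_coordField (hz.isInvertible (z.map_target hζ)) ?_
  have h1 := mfderiv_comp_apply ζ (hz.mdifferentiableAt (z.map_target hζ))
    (hz.mdifferentiableAt_symm hζ) w
  rw [← h1]
  have e : z ∘ z.symm =ᶠ[𝓝 ζ] id := by
    filter_upwards [z.open_target.mem_nhds hζ] with ξ hξ
    exact z.right_inv hξ
  have h2 := e.mfderiv_eq (I := 𝓘(ℝ, ℂ)) (I' := 𝓘(ℝ, ℂ))
  rw [mfderiv_id] at h2
  exact congrArg (fun A : ℂ →L[ℝ] ℂ ↦ A w) h2

lemma fderiv_comp_symm {F : Type*} [NormedAddCommGroup F] [NormedSpace ℝ F] {h : S → F}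
    (hζ : ζ ∈ z.target) (hh : MDifferentiableAt (𝓡 2) 𝓘(ℝ, F) h (z.symm ζ)) (w : ℂ) :
    fderiv ℝ (h ∘ z.symm) ζ w = mvfderiv (𝓡 2) h (z.symm ζ) (coordField (𝓡 2) z w (z.symm ζ)) := by
  have h1 := mfderiv_comp_apply ζ hh (hz.mdifferentiableAt_symm hζ) w
  rw [hz.mfderiv_symm hζ] at h1
  rw [← mfderiv_eq_fderiv]
  exact h1

lemma differentiableAt_comp_symm {F : Type*} [NormedAddCommGroup F] [NormedSpace ℝ F] {h : S → F}
    (hζ : ζ ∈ z.target) (hh : MDifferentiableAt (𝓡 2) 𝓘(ℝ, F) h (z.symm ζ)) :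
    DifferentiableAt ℝ (h ∘ z.symm) ζ :=
  (hh.comp ζ (hz.mdifferentiableAt_symm hζ)).differentiableAt

lemma diffTangentAt (hq : q ∈ z.source) (w : ℂ) : DiffTangentAt (coordField (𝓡 2) z w) q :=
  MDifferentiableAt.mpullback_vectorField (mdifferentiableAt_modelField w _) (hz.contMDiffAt hq)
    (hz.isInvertible hq) (by decide)

lemma eventually_mvfderiv_eq {h : S → ℝ} (hq : q ∈ z.source)
    (hh : ContMDiffAt (𝓡 2) 𝓘(ℝ, ℝ) ∞ h q) (w : ℂ) :
    (fun r ↦ mvfderiv (𝓡 2) h r (coordField (𝓡 2) z w r)) =ᶠ[𝓝 q]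
      (fun ζ ↦ fderiv ℝ (h ∘ z.symm) ζ w) ∘ z := by
  have h1 : ∀ᶠ r in 𝓝 q, ContMDiffAt (𝓡 2) 𝓘(ℝ, ℝ) 1 h r :=
    (contMDiffAt_iff_contMDiffAt_nhds (by simp)).1 (hh.of_le (by decide))
  filter_upwards [h1, z.open_source.mem_nhds hq] with r hr hr'
  have h2 := hz.fderiv_comp_symm (z.map_source hr') (h := h)
    (by rw [z.left_inv hr']; exact hr.mdifferentiableAt (by simp)) w
  rw [z.left_inv hr'] at h2
  exact h2.symm

lemma contDiffAt_comp_symm {h : S → ℝ} (hq : q ∈ z.source)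
    (hh : ContMDiffAt (𝓡 2) 𝓘(ℝ, ℝ) ∞ h q) : ContDiffAt ℝ ∞ (h ∘ z.symm) (z q) := by
  rw [← contMDiffAt_iff_contDiffAt]
  refine ContMDiffAt.comp (z q) ?_ (hz.contMDiffAt_symm (z.map_source hq))
  rw [z.left_inv hq]
  exact hh

lemma differentiableAt_fderiv {h : S → ℝ} (hq : q ∈ z.source)
    (hh : ContMDiffAt (𝓡 2) 𝓘(ℝ, ℝ) ∞ h q) :
    DifferentiableAt ℝ (fderiv ℝ (h ∘ z.symm)) (z q) :=
  ((hz.contDiffAt_comp_symm hq hh).fderiv_right (m := 1) (by decide)).differentiableAt (by simp)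

lemma mdifferentiableAt_mvfderiv {h : S → ℝ} (hq : q ∈ z.source)
    (hh : ContMDiffAt (𝓡 2) 𝓘(ℝ, ℝ) ∞ h q) (w : ℂ) :
    MDifferentiableAt (𝓡 2) 𝓘(ℝ, ℝ) (fun r ↦ mvfderiv (𝓡 2) h r (coordField (𝓡 2) z w r)) q := by
  refine MDifferentiableAt.congr_of_eventuallyEq ?_ (hz.eventually_mvfderiv_eq hq hh w)
  refine MDifferentiableAt.comp q ?_ (hz.mdifferentiableAt hq)
  exact ((hz.differentiableAt_fderiv hq hh).clm_apply
    (differentiableAt_const w)).mdifferentiableAt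

/-- Coordinate fields are constant when read in the chart, so the iterated derivative is a pure
Hessian; its symmetry gives `commuteAt`. -/
lemma mvfderiv_mvfderiv {h : S → ℝ} (hq : q ∈ z.source)
    (hh : ContMDiffAt (𝓡 2) 𝓘(ℝ, ℝ) ∞ h q) (v w : ℂ) :
    mvfderiv (𝓡 2) (fun r ↦ mvfderiv (𝓡 2) h r (coordField (𝓡 2) z w r)) q
      (coordField (𝓡 2) z v q) = fderiv ℝ (fderiv ℝ (h ∘ z.symm)) (z q) v w := by
  have hd := hz.mdifferentiableAt_mvfderiv hq hh w
  have h1 := hz.fderiv_comp_symm (z.map_source hq) (by rw [z.left_inv hq]; exact hd) v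
  rw [z.left_inv hq] at h1
  rw [← h1]
  have e : (fun r ↦ mvfderiv (𝓡 2) h r (coordField (𝓡 2) z w r)) ∘ z.symm =ᶠ[𝓝 (z q)]
      fun ζ ↦ fderiv ℝ (h ∘ z.symm) ζ w := by
    have h2 := hz.eventually_mvfderiv_eq hq hh w
    have hc : Filter.Tendsto z.symm (𝓝 (z q)) (𝓝 q) := by
      have := z.continuousAt_symm (z.map_source hq)
      rwa [ContinuousAt, z.left_inv hq] at this
    filter_upwards [hc.eventually h2, z.open_target.mem_nhds (z.map_source hq)] with ζ h3 h4
    rw [Function.comp_apply, h3, Function.comp_apply, z.right_inv h4]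
  rw [e.fderiv_eq, fderiv_clm_apply (hz.differentiableAt_fderiv hq hh) (differentiableAt_const w)]
  simp

lemma commuteAt (hq : q ∈ z.source) (v w : ℂ) :
    CommuteAt (coordField (𝓡 2) z v) (coordField (𝓡 2) z w) q where
  diff_left := hz.diffTangentAt hq v
  diff_right := hz.diffTangentAt hq w
  deriv_left h hh := hz.mdifferentiableAt_mvfderiv hq hh v
  deriv_right h hh := hz.mdifferentiableAt_mvfderiv hq hh w
  comm h hh := by
    rw [hz.mvfderiv_mvfderiv hq hh, hz.mvfderiv_mvfderiv hq hh]
    have hs := (hz.contDiffAt_comp_symm hq hh).isSymmSndFDerivAt (by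
      simp only [minSmoothness_of_isRCLikeNormedField]; decide)
    exact hs v w

end IsComplexChart

/-! ### Quadratic differentials and change of complex coordinate -/

section Quadratic

variable {S : Type*} [TopologicalSpace S] [ChartedSpace (EuclideanSpace ℝ (Fin 2)) S]
  [IsManifold (𝓡 2) ∞ S]
  {J : ∀ p : S, TangentSpace (𝓡 2) p →ₗ[ℝ] TangentSpace (𝓡 2) p}
  {z w : OpenPartialHomeomorph S ℂ} {q : S} {ζ : ℂ}

/-- The value `B(∂z, ∂z)` at a point of the surface. -/
def quadValue (B : ∀ p : S, LinearMap.BilinForm ℝ (TangentSpace (𝓡 2) p))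
    (z : OpenPartialHomeomorph S ℂ) (q : S) : ℂ :=
  ((B q (coordField (𝓡 2) z 1 q) (coordField (𝓡 2) z 1 q) -
      B q (coordField (𝓡 2) z Complex.I q) (coordField (𝓡 2) z Complex.I q) : ℝ) -
    Complex.I * (B q (coordField (𝓡 2) z 1 q) (coordField (𝓡 2) z Complex.I q) +
      B q (coordField (𝓡 2) z Complex.I q) (coordField (𝓡 2) z 1 q) : ℝ)) / 4

lemma quadCoeff_eq (hz : IsComplexChart J z)
    (B : ∀ p : S, LinearMap.BilinForm ℝ (TangentSpace (𝓡 2) p)) (hζ : ζ ∈ z.target) :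
    quadCoeff B z ζ = quadValue B z (z.symm ζ) := by
  have h : wirtinger z ζ = (1 / 2 : ℂ) ⊗ₜ[ℝ] coordField (𝓡 2) z 1 (z.symm ζ) -
      (Complex.I / 2) ⊗ₜ[ℝ] coordField (𝓡 2) z Complex.I (z.symm ζ) := by
    rw [← hz.mfderiv_symm hζ, ← hz.mfderiv_symm hζ]
    rfl
  simp only [quadCoeff, h, quadValue]
  simp only [map_sub, LinearMap.sub_apply, LinearMap.BilinForm.baseChange_tmul]
  apply Complex.ext <;> simp <;> ring

lemma quadCoeff_apply (hz : IsComplexChart J z)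
    (B : ∀ p : S, LinearMap.BilinForm ℝ (TangentSpace (𝓡 2) p)) (hq : q ∈ z.source) :
    quadCoeff B z (z q) = quadValue B z q := by
  rw [quadCoeff_eq hz B (z.map_source hq), z.left_inv hq]

/-- The coordinate change between complex charts is holomorphic. -/
lemma hasDerivAt_coordChange (hz : IsComplexChart J z) (hw : IsComplexChart J w)
    (hq : q ∈ z.source) (hq' : q ∈ w.source) :
    HasDerivAt (w ∘ z.symm) (mvfderiv (𝓡 2) w q (coordField (𝓡 2) z 1 q)) (z q) := by
  have hd : MDifferentiableAt (𝓡 2) 𝓘(ℝ, ℂ) w (z.symm (z q)) := by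
    rw [z.left_inv hq]; exact hw.mdifferentiableAt hq'
  have h1 := hz.fderiv_comp_symm (z.map_source hq) hd
  have h2 := hz.differentiableAt_comp_symm (z.map_source hq) hd
  rw [z.left_inv hq] at h1
  -- Both charts turn `J` into multiplication by i, so the real derivative of the coordinate change
  -- is complex linear.
  have h3 : fderiv ℝ (w ∘ z.symm) (z q) Complex.I =
      Complex.I • fderiv ℝ (w ∘ z.symm) (z q) 1 := by
    rw [h1, h1, ← hz.J_coordField_one hq, hw.map_J q hq', smul_eq_mul]
  have h4 := complexOfReal_hasDerivAt h2 h3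
  have h5 : (fderiv ℝ (w ∘ z.symm) (z q)).complexOfReal h3 1 =
      mvfderiv (𝓡 2) w q (coordField (𝓡 2) z 1 q) := h1 1
  rwa [h5] at h4

/-- With c = dw/dz one has ∂z = c ∂w; its real form is obtained by expanding the first coordinate
field and applying `J`. Complex bilinearity then produces c², also when `B` is not symmetric. -/
lemma quadValue_transform (hz : IsComplexChart J z) (hw : IsComplexChart J w)
    (B : ∀ p : S, LinearMap.BilinForm ℝ (TangentSpace (𝓡 2) p))
    (hq : q ∈ z.source) (hq' : q ∈ w.source) :
    quadValue B z q = quadValue B w q * mvfderiv (𝓡 2) w q (coordField (𝓡 2) z 1 q) ^ 2 := by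
  set c := mvfderiv (𝓡 2) w q (coordField (𝓡 2) z 1 q) with hc
  have h1 : coordField (𝓡 2) z 1 q = c.re • coordField (𝓡 2) w 1 q +
      c.im • coordField (𝓡 2) w Complex.I q := by
    rw [← hw.coordField_eq hq', hc, hw.coordField_mvfderiv hq']
  have h2 : coordField (𝓡 2) z Complex.I q = c.re • coordField (𝓡 2) w Complex.I q -
      c.im • coordField (𝓡 2) w 1 q := by
    rw [← hz.J_coordField_one hq, h1, map_add, map_smul, map_smul, hw.J_coordField_one hq',
      hw.J_coordField_I hq', smul_neg, ← sub_eq_add_neg]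
  unfold quadValue
  rw [h1, h2]
  simp only [map_add, map_sub, map_smul, LinearMap.add_apply, LinearMap.sub_apply,
    LinearMap.smul_apply, smul_eq_mul]
  apply Complex.ext <;> simp [pow_two] <;> ring

lemma quadCoeff_transform (hz : IsComplexChart J z) (hw : IsComplexChart J w)
    (B : ∀ p : S, LinearMap.BilinForm ℝ (TangentSpace (𝓡 2) p))
    (hq : q ∈ z.source ∩ w.source) :
    quadCoeff B z (z q) = quadCoeff B w (w q) * deriv (w ∘ z.symm) (z q) ^ 2 := by
  rw [quadCoeff_apply hz B hq.1, quadCoeff_apply hw B hq.2,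
    (hasDerivAt_coordChange hz hw hq.1 hq.2).deriv, quadValue_transform hz hw B hq.1 hq.2]

end Quadratic

/-! ### Conformal coordinates: W, 𝑯 and III in terms of the coefficients of II -/

namespace OrientedSurface

variable {M : Type*} [TopologicalSpace M] [ChartedSpace (EuclideanSpace ℝ (Fin 3)) M]
  [IsManifold (𝓡 3) ∞ M] [RiemannianBundle (fun x : M ↦ TangentSpace (𝓡 3) x)]
  {S : Type*} [TopologicalSpace S] [ChartedSpace (EuclideanSpace ℝ (Fin 2)) S]
  [IsManifold (𝓡 2) ∞ S] (Γ : OrientedSurface M S)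
  (cov : CovariantDerivative (𝓡 3) (EuclideanSpace ℝ (Fin 3)) (TangentSpace (𝓡 3) : M → Type _))
  {o : ManifoldOrientation M} {z : OpenPartialHomeomorph S ℂ} {q : S}

lemma metric_comm (q : S) (u v : TangentSpace (𝓡 2) q) : Γ.metric q u v = Γ.metric q v u := by
  rw [metric_apply, metric_apply, real_inner_comm]

lemma metric_J (q : S) (u v : TangentSpace (𝓡 2) q) : Γ.metric q (Γ.J o q u) v = Γ.area o q u v :=
  Γ.metric_sharp q _ v

lemma metric_W (q : S) (u v : TangentSpace (𝓡 2) q) :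
    Γ.metric q (Γ.W cov q u) v = Γ.II cov q u v :=
  Γ.metric_sharp q _ v

lemma metric_tang (q : S) (v : TangentSpace (𝓡 3) (Γ.incl q)) (u : TangentSpace (𝓡 2) q) :
    Γ.metric q (Γ.tang q v) u = inner ℝ v (Γ.d q u) :=
  Γ.metric_sharp q _ u

lemma area_self (q : S) (u : TangentSpace (𝓡 2) q) : Γ.area o q u u = 0 :=
  AlternatingMap.map_eq_zero_of_eq (i := 1) (j := 2) _ _ rfl (by decide)

lemma area_swap (q : S) (u v : TangentSpace (𝓡 2) q) : Γ.area o q u v = -Γ.area o q v u := by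
  have h := Γ.area_self (o := o) q (u + v)
  simp only [map_add, LinearMap.add_apply, area_self] at h
  linarith

/-- The conformal factor of the metric in the coordinate `z`. -/
def conformalFactor (z : OpenPartialHomeomorph S ℂ) (q : S) : ℝ :=
  Γ.metric q (coordField (𝓡 2) z 1 q) (coordField (𝓡 2) z 1 q)

/-- The components of the second fundamental form in the coordinate `z`. -/
def coeffII (z : OpenPartialHomeomorph S ℂ) (v w : ℂ) (q : S) : ℝ :=
  Γ.II cov q (coordField (𝓡 2) z v q) (coordField (𝓡 2) z w q)

lemma metric_coordField_self_pos (z : OpenPartialHomeomorph S ℂ) {w : ℂ}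
    (h : coordField (𝓡 2) z w q ≠ 0) :
    0 < Γ.metric q (coordField (𝓡 2) z w q) (coordField (𝓡 2) z w q) := by
  rw [metric_apply, real_inner_self_eq_norm_sq]
  have : Γ.d q (coordField (𝓡 2) z w q) ≠ 0 := fun h0 ↦
    h ((injective_iff_map_eq_zero (Γ.d q)).1 (Γ.d_injective q) _ h0)
  positivity

section Chart

variable (hz : IsComplexChart (Γ.J o) z) (hq : q ∈ z.source)
include hz hq

lemma conformalFactor_pos : 0 < Γ.conformalFactor z q := by
  refine Γ.metric_coordField_self_pos z fun h ↦ ?_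
  have := hz.mvfderiv_coordField hq 1
  rw [h, map_zero] at this
  exact zero_ne_one this

/-- Conformality of the chart needs only ⟨Ju, v⟩ = dA(u, v), the antisymmetry of dA, and J∂x = ∂y,
J∂y = -∂x. Here dA(∂x, ∂y) is traded for |∂x|²; the next two lemmas trade it for |∂y|² and get
orthogonality from dA(∂x, ∂x) = 0. -/
lemma area_one_I : Γ.area o q (coordField (𝓡 2) z 1 q) (coordField (𝓡 2) z Complex.I q) =
    Γ.conformalFactor z q := by
  have h := Γ.metric_J (o := o) q (coordField (𝓡 2) z Complex.I q) (coordField (𝓡 2) z 1 q)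
  rw [hz.J_coordField_I hq, Γ.area_swap, map_neg, LinearMap.neg_apply, neg_inj] at h
  exact h.symm

lemma metric_I_I : Γ.metric q (coordField (𝓡 2) z Complex.I q) (coordField (𝓡 2) z Complex.I q) =
    Γ.conformalFactor z q := by
  rw [← Γ.area_one_I hz hq, ← metric_J, hz.J_coordField_one hq]

lemma metric_I_one : Γ.metric q (coordField (𝓡 2) z Complex.I q) (coordField (𝓡 2) z 1 q) = 0 := by
  rw [← Γ.area_self (o := o) q (coordField (𝓡 2) z 1 q), ← metric_J, hz.J_coordField_one hq]

lemma metric_one_I : Γ.metric q (coordField (𝓡 2) z 1 q) (coordField (𝓡 2) z Complex.I q) = 0 := by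
  rw [metric_comm, Γ.metric_I_one hz hq]

lemma eq_smul_add_smul (u : TangentSpace (𝓡 2) q) :
    u = (Γ.metric q u (coordField (𝓡 2) z 1 q) / Γ.conformalFactor z q) • coordField (𝓡 2) z 1 q +
      (Γ.metric q u (coordField (𝓡 2) z Complex.I q) / Γ.conformalFactor z q) •
        coordField (𝓡 2) z Complex.I q := by
  have hl := (Γ.conformalFactor_pos hz hq).ne'
  have h := hz.coordField_eq hq (mvfderiv (𝓡 2) z q u)
  rw [hz.coordField_mvfderiv hq] at h
  have h11 : Γ.metric q (coordField (𝓡 2) z 1 q) (coordField (𝓡 2) z 1 q) =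
    Γ.conformalFactor z q := rfl
  have h1 : Γ.metric q u (coordField (𝓡 2) z 1 q) =
      (mvfderiv (𝓡 2) z q u).re * Γ.conformalFactor z q := by
    conv_lhs => rw [h]
    simp [Γ.metric_I_one hz hq, h11]
  have h2 : Γ.metric q u (coordField (𝓡 2) z Complex.I q) =
      (mvfderiv (𝓡 2) z q u).im * Γ.conformalFactor z q := by
    conv_lhs => rw [h]
    simp [Γ.metric_one_I hz hq, Γ.metric_I_I hz hq]
  rw [h1, h2, mul_div_cancel_right₀ _ hl, mul_div_cancel_right₀ _ hl]
  exact h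

lemma W_coordField (v : ℂ) : Γ.W cov q (coordField (𝓡 2) z v q) =
    (Γ.coeffII cov z v 1 q / Γ.conformalFactor z q) • coordField (𝓡 2) z 1 q +
      (Γ.coeffII cov z v Complex.I q / Γ.conformalFactor z q) • coordField (𝓡 2) z Complex.I q := by
  conv_lhs => rw [Γ.eq_smul_add_smul hz hq (Γ.W cov q (coordField (𝓡 2) z v q))]
  rw [metric_W, metric_W]
  rfl

/-- The coordinate vector fields as a basis of the tangent space. -/
def coordBasis : Module.Basis (Fin 2) ℝ (TangentSpace (𝓡 2) q) :=
  Module.Basis.mk (v := ![coordField (𝓡 2) z 1 q, coordField (𝓡 2) z Complex.I q])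
    (by
      rw [LinearIndependent.pair_iff]
      intro s t h
      have h1 := congrArg (mvfderiv (𝓡 2) z q) h
      rw [map_add, map_smul, map_smul, hz.mvfderiv_coordField hq, hz.mvfderiv_coordField hq,
        map_zero] at h1
      have hr := congrArg Complex.re h1
      have hi := congrArg Complex.im h1
      simp at hr hi
      exact ⟨hr, hi⟩)
    (by
      intro u _
      rw [Γ.eq_smul_add_smul hz hq u]
      refine Submodule.add_mem _ (Submodule.smul_mem _ _ (Submodule.subset_span ⟨0, rfl⟩))
        (Submodule.smul_mem _ _ (Submodule.subset_span ⟨1, rfl⟩)))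

lemma coordBasis_zero : Γ.coordBasis hz hq 0 = coordField (𝓡 2) z 1 q := by
  simp [coordBasis]

lemma coordBasis_one : Γ.coordBasis hz hq 1 = coordField (𝓡 2) z Complex.I q := by
  simp [coordBasis]

lemma meanCurvature_eq : Γ.meanCurvature cov q =
    (Γ.coeffII cov z 1 1 q + Γ.coeffII cov z Complex.I Complex.I q) / Γ.conformalFactor z q := by
  have e : ∀ v, Γ.W cov q (coordField (𝓡 2) z v q) =
      (Γ.coeffII cov z v 1 q / Γ.conformalFactor z q) • Γ.coordBasis hz hq 0 +
        (Γ.coeffII cov z v Complex.I q / Γ.conformalFactor z q) • Γ.coordBasis hz hq 1 := by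
    intro v
    rw [coordBasis_zero, coordBasis_one, Γ.W_coordField cov hz hq]
  have e0 := e 1
  have e1 := e Complex.I
  rw [← Γ.coordBasis_zero hz hq] at e0
  rw [← Γ.coordBasis_one hz hq] at e1
  rw [meanCurvature, LinearMap.trace_eq_matrix_trace ℝ (Γ.coordBasis hz hq), Matrix.trace_fin_two,
    LinearMap.toMatrix_apply, LinearMap.toMatrix_apply, e0, e1]
  simp only [map_add, map_smul, Module.Basis.repr_self]
  simp [add_div]

/-- In the basis ∂z, ∂z̄ only the cross terms of ⟨W∂z, W∂z⟩ survive, because ∂z and ∂z̄ are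
isotropic. They give (4/l) II(∂z, ∂z̄) II(∂z, ∂z). -/
lemma quadValue_III_eq : quadValue (Γ.III cov) z q =
    ((Γ.coeffII cov z 1 1 q + Γ.coeffII cov z Complex.I Complex.I q : ℝ) +
      Complex.I * (Γ.coeffII cov z 1 Complex.I q - Γ.coeffII cov z Complex.I 1 q : ℝ)) /
      Γ.conformalFactor z q * quadValue (Γ.II cov) z q := by
  have hl := (Γ.conformalFactor_pos hz hq).ne'
  have h11 : Γ.metric q (coordField (𝓡 2) z 1 q) (coordField (𝓡 2) z 1 q) =
    Γ.conformalFactor z q := rfl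
  have key : ∀ v w, Γ.III cov q (coordField (𝓡 2) z v q) (coordField (𝓡 2) z w q) =
      (Γ.coeffII cov z v 1 q * Γ.coeffII cov z w 1 q +
        Γ.coeffII cov z v Complex.I q * Γ.coeffII cov z w Complex.I q) /
        Γ.conformalFactor z q := by
    intro v w
    have : Γ.III cov q (coordField (𝓡 2) z v q) (coordField (𝓡 2) z w q) =
      Γ.metric q (Γ.W cov q (coordField (𝓡 2) z v q)) (Γ.W cov q (coordField (𝓡 2) z w q)) := rfl
    rw [this, Γ.W_coordField cov hz hq, Γ.W_coordField cov hz hq]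
    simp only [map_add, map_smul, LinearMap.add_apply, LinearMap.smul_apply, smul_eq_mul, h11,
      Γ.metric_I_one hz hq, Γ.metric_one_I hz hq, Γ.metric_I_I hz hq]
    field_simp
    ring
  have hl' : (Γ.conformalFactor z q : ℂ) ≠ 0 := by exact_mod_cast hl
  simp only [quadValue, key]
  change _ = _ / _ * (((Γ.coeffII cov z 1 1 q - Γ.coeffII cov z Complex.I Complex.I q : ℝ) -
    Complex.I * (Γ.coeffII cov z 1 Complex.I q + Γ.coeffII cov z Complex.I 1 q : ℝ)) / 4)
  push_cast
  field_simp
  ring_nf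
  simp only [Complex.I_sq]
  ring

/-- Pair the torsion formula for the commuting fields ∂x, ∂y with `N`: the torsion measures the
asymmetry of II. -/
lemma τ_one_I : Γ.τ cov q (coordField (𝓡 2) z 1 q) (coordField (𝓡 2) z Complex.I q) =
    Γ.coeffII cov z 1 Complex.I q - Γ.coeffII cov z Complex.I 1 q := by
  have h := covAlong_sub_eq_torsion (cov := cov) Γ.isSmoothEmbedding.contMDiff
    (hz.commuteAt hq 1 Complex.I)
  rw [τ, ← h, inner_sub_right, coeffII, coeffII, Γ.II_apply cov (hz.diffTangentAt hq _),
    Γ.II_apply cov (hz.diffTangentAt hq _)]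
  rfl

lemma starτ_eq : Γ.starτ cov o q =
    (Γ.coeffII cov z 1 Complex.I q - Γ.coeffII cov z Complex.I 1 q) / Γ.conformalFactor z q := by
  have hl := Γ.conformalFactor_pos hz hq
  rw [← Γ.τ_one_I cov hz hq]
  have harea := Γ.area_one_I hz hq
  rw [← harea] at hl ⊢
  -- `starτ` is defined in the standard basis. On a plane two alternating forms both change by the
  -- determinant of the frame, so their quotient may be computed on ∂x, ∂y instead.
  let b : Module.Basis (Fin 2) ℝ (TangentSpace (𝓡 2) q) :=
    (EuclideanSpace.basisFun (Fin 2) ℝ).toBasis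
  have hb : ∀ u : TangentSpace (𝓡 2) q, u = b.repr u 0 • b 0 + b.repr u 1 • b 1 := fun u ↦ by
    conv_lhs => rw [← b.sum_repr u]
    rw [Fin.sum_univ_two]
  have h0 : ∀ i, b i = (EuclideanSpace.basisFun (Fin 2) ℝ) i := fun i ↦
    congrFun (EuclideanSpace.basisFun (Fin 2) ℝ).coe_toBasis i
  have hτ : ∀ u v, Γ.τ cov q u v =
      (b.repr u 0 * b.repr v 1 - b.repr u 1 * b.repr v 0) * Γ.τ cov q (b 0) (b 1) := by
    intro u v
    have h10 : Γ.τ cov q (b 1) (b 0) = -Γ.τ cov q (b 0) (b 1) := by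
      rw [τ, CovariantDerivative.torsion_antisymm, inner_neg_right, τ]
    conv_lhs => rw [hb u, hb v]
    simp only [τ, map_add, map_smul, add_apply, smul_apply, inner_add_right,
      real_inner_smul_right, CovariantDerivative.torsion_self, inner_zero_right] at h10 ⊢
    rw [h10]
    ring
  have ha : ∀ u v, Γ.area o q u v =
      (b.repr u 0 * b.repr v 1 - b.repr u 1 * b.repr v 0) * Γ.area o q (b 0) (b 1) := by
    intro u v
    conv_lhs => rw [hb u, hb v]
    simp only [map_add, map_smul, LinearMap.add_apply, LinearMap.smul_apply, area_self,
      smul_eq_mul]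
    rw [Γ.area_swap q (b 1) (b 0)]
    ring
  have hs : Γ.starτ cov o q = Γ.τ cov q (b 0) (b 1) / Γ.area o q (b 0) (b 1) := by
    rw [h0, h0]; rfl
  rw [hs]
  rw [hτ (coordField (𝓡 2) z 1 q), ha (coordField (𝓡 2) z 1 q), mul_div_mul_left]
  rw [ha] at hl
  exact left_ne_zero_of_mul hl.ne'

lemma complexMeanCurvature_eq : Γ.complexMeanCurvature cov o q =
    ((Γ.coeffII cov z 1 1 q + Γ.coeffII cov z Complex.I Complex.I q : ℝ) +
      Complex.I * (Γ.coeffII cov z 1 Complex.I q - Γ.coeffII cov z Complex.I 1 q : ℝ)) /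
      Γ.conformalFactor z q := by
  rw [complexMeanCurvature, Γ.meanCurvature_eq cov hz hq, Γ.starτ_eq cov hz hq]
  push_cast
  ring

lemma quadValue_III : quadValue (Γ.III cov) z q =
    Γ.complexMeanCurvature cov o q * quadValue (Γ.II cov) z q := by
  rw [Γ.quadValue_III_eq cov hz hq, Γ.complexMeanCurvature_eq cov hz hq]

end Chart

end OrientedSurface

namespace OrientedSurface

variable {M : Type*} [TopologicalSpace M] [T2Space M]
  [ChartedSpace (EuclideanSpace ℝ (Fin 3)) M]
  [IsManifold (𝓡 3) ∞ M] [RiemannianBundle (fun x : M ↦ TangentSpace (𝓡 3) x)]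
  [IsContMDiffRiemannianBundle (𝓡 3) ∞ (EuclideanSpace ℝ (Fin 3))
    (fun x : M ↦ TangentSpace (𝓡 3) x)]
  {S : Type*} [TopologicalSpace S] [ChartedSpace (EuclideanSpace ℝ (Fin 2)) S]
  [IsManifold (𝓡 2) ∞ S] (Γ : OrientedSurface M S)
  {cov : CovariantDerivative (𝓡 3) (EuclideanSpace ℝ (Fin 3)) (TangentSpace (𝓡 3) : M → Type _)}
  [cov.ContMDiffCovariantDerivative ∞]
  (hcov : cov.IsMetricCompatible)
  {o : ManifoldOrientation M} {z : OpenPartialHomeomorph S ℂ} {q : S}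

omit [T2Space M] [IsContMDiffRiemannianBundle (𝓡 3) ∞ (EuclideanSpace ℝ (Fin 3))
    (fun x : M ↦ TangentSpace (𝓡 3) x)] in
lemma diffAlongAt_N (q : S) : DiffAlongAt Γ.incl Γ.N q :=
  Γ.smooth_N.mdifferentiable (by simp) q

/-! ### The Weingarten equation -/

section Weingarten

omit [T2Space M] [cov.ContMDiffCovariantDerivative ∞]
include hcov

/-- Differentiate ⟨N, Y⟩ = 0 for a field `Y` tangent to the surface and extending `v`. -/
lemma II_eq (u v : TangentSpace (𝓡 2) q) :
    Γ.II cov q u v = -inner ℝ (covAlong cov Γ.incl Γ.N q u) (Γ.d q v) := by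
  let Y := FiberBundle.extend (EuclideanSpace ℝ (Fin 2)) v
  have hY : DiffTangentAt Y q := FiberBundle.mdifferentiableAt_extend ..
  have hv : Y q = v := FiberBundle.extend_apply_self _ v
  have h := innerRule_covAlong hcov (Γ.diffAlongAt_N q) (Γ.diffAlong hY) u
  have h0 : (fun r ↦ inner ℝ (Γ.N r) (Γ.d r (Y r))) = fun _ ↦ (0 : ℝ) := by
    funext r
    exact Γ.inner_N r _
  have h1 := Γ.II_apply cov hY u
  rw [h0, mvfderiv_const, hv] at h
  rw [hv] at h1
  rw [h1, ambientCov]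
  simp only [zero_apply] at h
  linarith

/-- Differentiate ⟨N, N⟩ = 1. -/
lemma inner_covAlong_N (u : TangentSpace (𝓡 2) q) :
    inner ℝ (covAlong cov Γ.incl Γ.N q u) (Γ.N q) = 0 := by
  have h := innerRule_covAlong hcov (Γ.diffAlongAt_N q) (Γ.diffAlongAt_N q) u
  have h0 : (fun r ↦ inner ℝ (Γ.N r) (Γ.N r)) = fun _ ↦ (1 : ℝ) := by
    funext r
    rw [real_inner_self_eq_norm_sq, Γ.norm_N, one_pow]
  rw [h0, mvfderiv_const, real_inner_comm (covAlong cov Γ.incl Γ.N q u)] at h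
  simp only [zero_apply] at h
  linarith

/-- The Weingarten equation. -/
lemma covAlong_N (hz : IsComplexChart (Γ.J o) z) (hq : q ∈ z.source) (u : TangentSpace (𝓡 2) q) :
    covAlong cov Γ.incl Γ.N q u = -Γ.d q (Γ.W cov q u) := by
  -- The two sides are compared against the orthogonal basis N, ∂x, ∂y. The chart serves only to
  -- provide it.
  let v : Fin 3 → TangentSpace (𝓡 3) (Γ.incl q) :=
    ![Γ.N q, Γ.d q (coordField (𝓡 2) z 1 q), Γ.d q (coordField (𝓡 2) z Complex.I q)]
  have hN : ∀ w, inner ℝ (Γ.N q) (Γ.d q w) = 0 := Γ.inner_N q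
  have hN' : ∀ w, inner ℝ (Γ.d q w) (Γ.N q) = 0 := fun w ↦ by rw [real_inner_comm, hN]
  have h12 := Γ.metric_one_I hz hq
  have h21 := Γ.metric_I_one hz hq
  have hl := Γ.conformalFactor_pos hz hq
  have hl' := hl
  rw [← Γ.metric_I_I hz hq] at hl'
  rw [conformalFactor] at hl
  rw [metric_apply] at h12 h21 hl hl'
  have hne : ∀ i, v i ≠ 0 := by
    intro i
    fin_cases i
    · intro h
      have h1 := Γ.norm_N q
      rw [show Γ.N q = 0 from h, norm_zero] at h1
      exact zero_ne_one h1
    · intro h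
      rw [show Γ.d q (coordField (𝓡 2) z 1 q) = 0 from h, inner_zero_left] at hl
      exact lt_irrefl _ hl
    · intro h
      rw [show Γ.d q (coordField (𝓡 2) z Complex.I q) = 0 from h, inner_zero_left] at hl'
      exact lt_irrefl _ hl'
  have hli : LinearIndependent ℝ v := by
    refine linearIndependent_of_ne_zero_of_inner_eq_zero hne fun i j hij ↦ ?_
    fin_cases i <;> fin_cases j <;> first | exact absurd rfl hij | exact hN _ | exact hN' _ | exact h12 | exact h21
  have hcard : Fintype.card (Fin 3) = Module.finrank ℝ (TangentSpace (𝓡 3) (Γ.incl q)) := by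
    rw [Fintype.card_fin]; exact (Fact.out : Module.finrank ℝ _ = 3).symm
  let b := basisOfLinearIndependentOfCardEqFinrank hli hcard
  refine InnerProductSpace.ext_inner_left_basis b fun i ↦ ?_
  have hd : ∀ w, inner ℝ (Γ.d q w) (covAlong cov Γ.incl Γ.N q u) =
      inner ℝ (Γ.d q w) (-Γ.d q (Γ.W cov q u)) := by
    intro w
    have h := Γ.metric_W cov q u w
    rw [Γ.II_eq hcov, metric_apply] at h
    rw [inner_neg_right, real_inner_comm, real_inner_comm (Γ.d q (Γ.W cov q u)), h, neg_neg]
  rw [coe_basisOfLinearIndependentOfCardEqFinrank]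
  fin_cases i
  · refine Eq.trans (real_inner_comm _ _) (Eq.trans (Γ.inner_covAlong_N hcov u) ?_)
    refine Eq.symm (Eq.trans (inner_neg_right _ _) ?_)
    rw [neg_eq_zero]
    exact hN _
  · exact hd _
  · exact hd _

end Weingarten

/-! ### The Codazzi equations in conformal coordinates -/

section Codazzi

variable (hz : IsComplexChart (Γ.J o) z) (hq : q ∈ z.source)
include hz hq

omit [IsContMDiffRiemannianBundle (𝓡 3) ∞ (EuclideanSpace ℝ (Fin 3))
    (fun x : M ↦ TangentSpace (𝓡 3) x)] in
lemma diffAlongAt_covAlong_N (v : ℂ) : DiffAlongAt Γ.incl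
    (fun r ↦ covAlong cov Γ.incl Γ.N r (coordField (𝓡 2) z v r)) q :=
  (hasCovAlong_covAlong Γ.isSmoothEmbedding.contMDiff Γ.smooth_N (hz.diffTangentAt hq v)
    fun _ hh ↦ hz.mdifferentiableAt_mvfderiv hq hh v).diff

include hcov in
-- `II` is defined pointwise by tensoriality. Its regularity is read off from -⟨∇̃N, ·⟩, an inner
-- product of differentiable fields along the surface.
lemma mdifferentiableAt_coeffII (v w : ℂ) :
    MDifferentiableAt (𝓡 2) 𝓘(ℝ, ℝ) (Γ.coeffII cov z v w) q := by
  have h := (mdifferentiableAt_inner_along (Γ.diffAlongAt_covAlong_N (cov := cov) hz hq v)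
    (Γ.diffAlong (hz.diffTangentAt hq w))).neg
  refine h.congr_of_eventuallyEq (Filter.Eventually.of_forall fun r ↦ ?_)
  exact Γ.II_eq hcov _ _

include hcov in
-- The product rule for -⟨∇̃_v N, ∂w⟩, with the Weingarten equation in the second term.
-- Antisymmetrizing `u` and `v` makes the second derivatives of `N` into curvature.
lemma mvfderiv_coeffII (v w : ℂ) (u : TangentSpace (𝓡 2) q) :
    mvfderiv (𝓡 2) (Γ.coeffII cov z v w) q u =
      -inner ℝ (covAlong cov Γ.incl
        (fun r ↦ covAlong cov Γ.incl Γ.N r (coordField (𝓡 2) z v r)) q u)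
        (Γ.d q (coordField (𝓡 2) z w q)) +
      inner ℝ (Γ.d q (Γ.W cov q (coordField (𝓡 2) z v q)))
        (Γ.ambientCov cov (coordField (𝓡 2) z w) q u) := by
  have h := innerRule_covAlong hcov (Γ.diffAlongAt_covAlong_N (cov := cov) hz hq v)
    (Γ.diffAlong (hz.diffTangentAt hq w)) u
  have e : Γ.coeffII cov z v w = -fun r ↦
      inner ℝ (covAlong cov Γ.incl Γ.N r (coordField (𝓡 2) z v r))
        (Γ.d r (coordField (𝓡 2) z w r)) := by
    funext r
    exact Γ.II_eq hcov _ _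
  rw [e, mvfderiv_neg, neg_apply, h, Γ.covAlong_N hcov hz hq, inner_neg_left, ambientCov]
  ring

omit [T2Space M] in
lemma mdifferentiableAt_conformalFactor :
    MDifferentiableAt (𝓡 2) 𝓘(ℝ, ℝ) (Γ.conformalFactor z) q :=
  mdifferentiableAt_inner_along (Γ.diffAlong (hz.diffTangentAt hq 1))
    (Γ.diffAlong (hz.diffTangentAt hq 1))

omit [T2Space M] [cov.ContMDiffCovariantDerivative ∞] in
include hcov in
lemma mvfderiv_conformalFactor (u : TangentSpace (𝓡 2) q) :
    mvfderiv (𝓡 2) (Γ.conformalFactor z) q u = 2 * inner ℝ (Γ.d q (coordField (𝓡 2) z 1 q))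
      (Γ.ambientCov cov (coordField (𝓡 2) z 1) q u) := by
  have h := innerRule_covAlong hcov (Γ.diffAlong (hz.diffTangentAt hq 1))
    (Γ.diffAlong (hz.diffTangentAt hq 1)) u
  refine Eq.trans h ?_
  rw [real_inner_comm, ambientCov, two_mul]

omit [T2Space M] [cov.ContMDiffCovariantDerivative ∞] in
include hcov in
-- The factor is also the square length of ∂y throughout the chart, so ⟨∇̃_u ∂x, ∂x⟩ = ⟨∇̃_u ∂y, ∂y⟩
-- = dl(u)/2.
lemma mvfderiv_conformalFactor' (u : TangentSpace (𝓡 2) q) :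
    mvfderiv (𝓡 2) (Γ.conformalFactor z) q u =
      2 * inner ℝ (Γ.d q (coordField (𝓡 2) z Complex.I q))
        (Γ.ambientCov cov (coordField (𝓡 2) z Complex.I) q u) := by
  have h := innerRule_covAlong hcov (Γ.diffAlong (hz.diffTangentAt hq Complex.I))
    (Γ.diffAlong (hz.diffTangentAt hq Complex.I)) u
  have e : Γ.conformalFactor z =ᶠ[𝓝 q] fun r ↦ inner ℝ (Γ.d r (coordField (𝓡 2) z Complex.I r))
      (Γ.d r (coordField (𝓡 2) z Complex.I r)) := by
    filter_upwards [z.open_source.mem_nhds hq] with r hr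
    exact (Γ.metric_I_I hz hr).symm
  rw [mvfderiv_congr e]
  refine Eq.trans h ?_
  rw [real_inner_comm, ambientCov, two_mul]

omit [T2Space M] [cov.ContMDiffCovariantDerivative ∞] in
include hcov in
-- Differentiate ⟨∂x, ∂y⟩ = 0. The common value θ(u) = ⟨∇̃_u ∂x, ∂y⟩ = -⟨∂x, ∇̃_u ∂y⟩ is the
-- coefficient that metric compatibility leaves undetermined.
lemma inner_ambientCov_add (u : TangentSpace (𝓡 2) q) :
    inner ℝ (Γ.d q (coordField (𝓡 2) z Complex.I q))
      (Γ.ambientCov cov (coordField (𝓡 2) z 1) q u) +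
    inner ℝ (Γ.d q (coordField (𝓡 2) z 1 q))
      (Γ.ambientCov cov (coordField (𝓡 2) z Complex.I) q u) = 0 := by
  have h := innerRule_covAlong hcov (Γ.diffAlong (hz.diffTangentAt hq 1))
    (Γ.diffAlong (hz.diffTangentAt hq Complex.I)) u
  have e : (fun r ↦ inner ℝ (Γ.d r (coordField (𝓡 2) z 1 r))
      (Γ.d r (coordField (𝓡 2) z Complex.I r))) =ᶠ[𝓝 q] fun _ ↦ (0 : ℝ) := by
    filter_upwards [z.open_source.mem_nhds hq] with r hr
    exact Γ.metric_one_I hz hr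
  rw [mvfderiv_congr e, mvfderiv_const] at h
  rw [real_inner_comm]
  exact h.symm

omit [T2Space M] [cov.ContMDiffCovariantDerivative ∞] [IsContMDiffRiemannianBundle (𝓡 3) ∞
    (EuclideanSpace ℝ (Fin 3)) (fun x : M ↦ TangentSpace (𝓡 3) x)] in
-- Since [∂x, ∂y] = 0, the torsion of the surface is the tangential part of ∇̃_x ∂y - ∇̃_y ∂x.
lemma metric_torsion (w : TangentSpace (𝓡 2) q) :
    Γ.metric q ((Γ.inducedConnection cov).torsion q (coordField (𝓡 2) z 1 q)
      (coordField (𝓡 2) z Complex.I q)) w =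
    inner ℝ (Γ.d q w) (Γ.ambientCov cov (coordField (𝓡 2) z Complex.I) q (coordField (𝓡 2) z 1 q)) -
    inner ℝ (Γ.d q w) (Γ.ambientCov cov (coordField (𝓡 2) z 1) q
      (coordField (𝓡 2) z Complex.I q)) := by
  rw [CovariantDerivative.torsion_apply _ (hz.diffTangentAt hq 1) (hz.diffTangentAt hq Complex.I),
    mlieBracket_coordField (hz.contMDiffAt hq), sub_zero, map_sub, LinearMap.sub_apply,
    real_inner_comm, real_inner_comm (Γ.ambientCov cov (coordField (𝓡 2) z 1) q _),
    ← metric_tang, ← metric_tang]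
  rfl

omit [T2Space M] [IsContMDiffRiemannianBundle (𝓡 3) ∞ (EuclideanSpace ℝ (Fin 3))
    (fun x : M ↦ TangentSpace (𝓡 3) x)] [cov.ContMDiffCovariantDerivative ∞] in
/-- The inner product of `J W J v` with the coordinate fields. -/
lemma metric_JWJ (v : TangentSpace (𝓡 2) q) :
    Γ.conformalFactor z q * Γ.metric q (Γ.J o q (Γ.W cov q (Γ.J o q v))) (coordField (𝓡 2) z 1 q) =
      -Γ.coeffII cov z Complex.I Complex.I q * Γ.metric q v (coordField (𝓡 2) z 1 q) +
        Γ.coeffII cov z 1 Complex.I q * Γ.metric q v (coordField (𝓡 2) z Complex.I q) ∧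
    Γ.conformalFactor z q *
      Γ.metric q (Γ.J o q (Γ.W cov q (Γ.J o q v))) (coordField (𝓡 2) z Complex.I q) =
      Γ.coeffII cov z Complex.I 1 q * Γ.metric q v (coordField (𝓡 2) z 1 q) -
        Γ.coeffII cov z 1 1 q * Γ.metric q v (coordField (𝓡 2) z Complex.I q) := by
  have hl := (Γ.conformalFactor_pos hz hq).ne'
  have h11 : Γ.metric q (coordField (𝓡 2) z 1 q) (coordField (𝓡 2) z 1 q) =
    Γ.conformalFactor z q := rfl
  have hv := Γ.eq_smul_add_smul hz hq v
  set s := Γ.metric q v (coordField (𝓡 2) z 1 q)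
  set t := Γ.metric q v (coordField (𝓡 2) z Complex.I q)
  rw [hv]
  simp only [map_add, map_smul, hz.J_coordField_one hq, hz.J_coordField_I hq, map_neg,
    Γ.W_coordField cov hz hq, LinearMap.add_apply, LinearMap.smul_apply, LinearMap.neg_apply,
    Γ.metric_I_one hz hq, Γ.metric_one_I hz hq, Γ.metric_I_I hz hq, h11, smul_eq_mul]
  constructor <;> field_simp <;> ring

include hcov in
/-- The Codazzi equations in a complex coordinate, under the assumption `L = 0`. -/
lemma codazzi (hL : ∀ u v : TangentSpace (𝓡 2) q, Γ.L cov o q u v = 0) :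
    2 * Γ.conformalFactor z q *
        (mvfderiv (𝓡 2) (Γ.coeffII cov z Complex.I 1) q (coordField (𝓡 2) z 1 q) -
          mvfderiv (𝓡 2) (Γ.coeffII cov z 1 1) q (coordField (𝓡 2) z Complex.I q)) =
      -mvfderiv (𝓡 2) (Γ.conformalFactor z) q (coordField (𝓡 2) z 1 q) *
          (Γ.coeffII cov z 1 Complex.I q - Γ.coeffII cov z Complex.I 1 q) -
        mvfderiv (𝓡 2) (Γ.conformalFactor z) q (coordField (𝓡 2) z Complex.I q) *
          (Γ.coeffII cov z 1 1 q + Γ.coeffII cov z Complex.I Complex.I q) ∧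
    2 * Γ.conformalFactor z q *
        (mvfderiv (𝓡 2) (Γ.coeffII cov z Complex.I Complex.I) q (coordField (𝓡 2) z 1 q) -
          mvfderiv (𝓡 2) (Γ.coeffII cov z 1 Complex.I) q (coordField (𝓡 2) z Complex.I q)) =
      mvfderiv (𝓡 2) (Γ.conformalFactor z) q (coordField (𝓡 2) z 1 q) *
          (Γ.coeffII cov z 1 1 q + Γ.coeffII cov z Complex.I Complex.I q) -
        mvfderiv (𝓡 2) (Γ.conformalFactor z) q (coordField (𝓡 2) z Complex.I q) *
          (Γ.coeffII cov z 1 Complex.I q - Γ.coeffII cov z Complex.I 1 q) := by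
  have hl := (Γ.conformalFactor_pos hz hq).ne'
  -- The only use of L = 0: the tangential curvature of `N` is replaced by J W J T.
  have hR : ∀ w, inner ℝ (covAlong cov Γ.incl
        (fun r ↦ covAlong cov Γ.incl Γ.N r (coordField (𝓡 2) z Complex.I r)) q
          (coordField (𝓡 2) z 1 q)) (Γ.d q w) -
      inner ℝ (covAlong cov Γ.incl
        (fun r ↦ covAlong cov Γ.incl Γ.N r (coordField (𝓡 2) z 1 r)) q
          (coordField (𝓡 2) z Complex.I q)) (Γ.d q w) =
      Γ.metric q (Γ.J o q (Γ.W cov q (Γ.J o q ((Γ.inducedConnection cov).torsion q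
        (coordField (𝓡 2) z 1 q) (coordField (𝓡 2) z Complex.I q))))) w := by
    intro w
    have h1 := covAlong_covAlong_sub (cov := cov) Γ.isSmoothEmbedding.contMDiff Γ.smooth_N
      (hz.commuteAt hq 1 Complex.I)
    have h2 := sub_eq_zero.1 (hL (coordField (𝓡 2) z 1 q) (coordField (𝓡 2) z Complex.I q))
    rw [← inner_sub_left, h1, metric_apply]
    exact congrArg (fun v ↦ inner ℝ v (Γ.d q w)) h2
  have hR1 := hR (coordField (𝓡 2) z 1 q)
  have hR2 := hR (coordField (𝓡 2) z Complex.I q)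
  obtain ⟨hJ1, hJ2⟩ := Γ.metric_JWJ (cov := cov) hz hq ((Γ.inducedConnection cov).torsion q
        (coordField (𝓡 2) z 1 q) (coordField (𝓡 2) z Complex.I q))
  rw [Γ.metric_torsion hz hq, Γ.metric_torsion hz hq] at hJ1 hJ2
  have hW : ∀ v (y : TangentSpace (𝓡 3) (Γ.incl q)), Γ.conformalFactor z q *
      inner ℝ (Γ.d q (Γ.W cov q (coordField (𝓡 2) z v q))) y =
      Γ.coeffII cov z v 1 q * inner ℝ (Γ.d q (coordField (𝓡 2) z 1 q)) y +
      Γ.coeffII cov z v Complex.I q * inner ℝ (Γ.d q (coordField (𝓡 2) z Complex.I q)) y := by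
    intro v y
    rw [Γ.W_coordField cov hz hq, map_add, map_smul, map_smul, inner_add_left,
      real_inner_smul_left, real_inner_smul_left]
    field_simp
  rw [Γ.mvfderiv_coeffII hcov hz hq, Γ.mvfderiv_coeffII hcov hz hq, Γ.mvfderiv_coeffII hcov hz hq,
    Γ.mvfderiv_coeffII hcov hz hq]
  have hc11 := Γ.mvfderiv_conformalFactor hcov hz hq (coordField (𝓡 2) z 1 q)
  have hc12 := Γ.mvfderiv_conformalFactor' hcov hz hq (coordField (𝓡 2) z 1 q)
  have hc21 := Γ.mvfderiv_conformalFactor hcov hz hq (coordField (𝓡 2) z Complex.I q)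
  have hc22 := Γ.mvfderiv_conformalFactor' hcov hz hq (coordField (𝓡 2) z Complex.I q)
  have hθ1 := Γ.inner_ambientCov_add hcov hz hq (coordField (𝓡 2) z 1 q)
  have hθ2 := Γ.inner_ambientCov_add hcov hz hq (coordField (𝓡 2) z Complex.I q)
  have w1 := hW 1 (Γ.ambientCov cov (coordField (𝓡 2) z 1) q (coordField (𝓡 2) z Complex.I q))
  have w2 := hW 1 (Γ.ambientCov cov (coordField (𝓡 2) z Complex.I) q
    (coordField (𝓡 2) z Complex.I q))
  have w3 := hW Complex.I (Γ.ambientCov cov (coordField (𝓡 2) z 1) q (coordField (𝓡 2) z 1 q))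
  have w4 := hW Complex.I (Γ.ambientCov cov (coordField (𝓡 2) z Complex.I) q
    (coordField (𝓡 2) z 1 q))
  set l := Γ.conformalFactor z q
  set h11 := Γ.coeffII cov z 1 1 q
  set h12 := Γ.coeffII cov z 1 Complex.I q
  set h21 := Γ.coeffII cov z Complex.I 1 q
  set h22 := Γ.coeffII cov z Complex.I Complex.I q
  constructor
  -- The free coefficients θ(∂x), θ(∂y) occur in `w1`, `w3` through W and in `hJ1` through T, with
  -- equal contributions; their difference leaves only dl. The second equation works in the same
  -- way.
  · linear_combination -2 * l * hR1 - 2 * hJ1 + 2 * w3 - 2 * w1 + 2 * h22 * hθ1 +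
      (h11 + h22) * hc21 + h12 * hc12 - h21 * hc11
  · linear_combination -2 * l * hR2 - 2 * hJ2 + 2 * w4 - 2 * w2 - 2 * h11 * hθ2 - h21 * hc21 -
      (h11 + h22) * hc12 + h12 * hc22

end Codazzi

end OrientedSurface

/-- The Cauchy–Riemann equations for the quotient `(a + i b) / l` of real functions. -/
lemma differentiableAt_div_iff {a b l : ℂ → ℝ} {ζ : ℂ} (ha : DifferentiableAt ℝ a ζ)
    (hb : DifferentiableAt ℝ b ζ) (hl : DifferentiableAt ℝ l ζ) (h0 : l ζ ≠ 0) :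
    DifferentiableAt ℂ (fun ξ ↦ ((a ξ : ℂ) + Complex.I * (b ξ : ℂ)) / (l ξ : ℂ)) ζ ↔
      l ζ * (fderiv ℝ a ζ 1 - fderiv ℝ b ζ Complex.I) =
        a ζ * fderiv ℝ l ζ 1 - b ζ * fderiv ℝ l ζ Complex.I ∧
      l ζ * (fderiv ℝ a ζ Complex.I + fderiv ℝ b ζ 1) =
        a ζ * fderiv ℝ l ζ Complex.I + b ζ * fderiv ℝ l ζ 1 := by
  have hof : ∀ {g : ℂ → ℝ}, DifferentiableAt ℝ g ζ →
      HasFDerivAt (fun ξ ↦ (g ξ : ℂ)) (Complex.ofRealCLM ∘L fderiv ℝ g ζ) ζ := fun hg ↦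
    Complex.ofRealCLM.hasFDerivAt.comp ζ hg.hasFDerivAt
  have h0' : (l ζ : ℂ) ≠ 0 := by exact_mod_cast h0
  set F : ℂ → ℂ := fun ξ ↦ ((a ξ : ℂ) + Complex.I * (b ξ : ℂ)) / (l ξ : ℂ) with hF
  have hn := (hof ha).add ((hof hb).const_mul Complex.I)
  have hFd : DifferentiableAt ℝ F ζ := by
    simp only [hF, div_eq_mul_inv]
    exact hn.differentiableAt.mul ((hof hl).differentiableAt.inv h0')
  have hm := (hof hl).mul hFd.hasFDerivAt
  -- Differentiating the identity l F = a + i b, and using uniqueness of the derivative, avoids the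
  -- derivative of a quotient.
  have hev : (fun ξ ↦ (l ξ : ℂ)) * F =ᶠ[𝓝 ζ] (fun ξ ↦ (a ξ : ℂ)) +
      fun ξ ↦ Complex.I * (b ξ : ℂ) := by
    have hne : ∀ᶠ ξ in 𝓝 ζ, l ξ ≠ 0 := hl.continuousAt.eventually_ne h0
    filter_upwards [hne] with ξ hξ
    have : (l ξ : ℂ) ≠ 0 := by exact_mod_cast hξ
    simp only [hF, Pi.mul_apply, Pi.add_apply]
    field_simp
  have hu := hm.unique (hn.congr_of_eventuallyEq hev)
  -- Two factors of l: one from the product rule, one to replace the remaining value F ζ by a + i b.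
  have hw : ∀ w, (l ζ : ℂ) * (l ζ * fderiv ℝ F ζ w) =
      l ζ * ((fderiv ℝ a ζ w : ℂ) + Complex.I * (fderiv ℝ b ζ w : ℂ)) -
        (a ζ + Complex.I * b ζ) * (fderiv ℝ l ζ w : ℂ) := by
    intro w
    have h := congrArg (fun A : ℂ →L[ℝ] ℂ ↦ A w) hu
    simp only [add_apply, smul_apply, ContinuousLinearMap.comp_apply, Complex.ofRealCLM_apply,
      smul_eq_mul] at h
    have hFζ : (l ζ : ℂ) * F ζ = a ζ + Complex.I * b ζ := by
      simp only [hF]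
      field_simp
    linear_combination (l ζ : ℂ) * h - (fderiv ℝ l ζ w : ℂ) * hFζ
  rw [differentiableAt_complex_iff_differentiableAt_real, and_iff_right hFd,
    ← mul_right_inj' h0', ← mul_right_inj' h0', hw, smul_eq_mul]
  have e : (l ζ : ℂ) * (l ζ * (Complex.I * fderiv ℝ F ζ 1)) =
      Complex.I * (l ζ * (l ζ * fderiv ℝ F ζ 1)) := by ring
  rw [e, hw, Complex.ext_iff]
  simp only [Complex.add_re, Complex.sub_re, Complex.mul_re, Complex.add_im, Complex.sub_im,
    Complex.mul_im, Complex.ofReal_re, Complex.ofReal_im, Complex.I_re, Complex.I_im]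
  constructor
  · rintro ⟨h1, h2⟩
    exact ⟨by linear_combination -h2, by linear_combination h1⟩
  · rintro ⟨h1, h2⟩
    exact ⟨by linear_combination h2, by linear_combination -h1⟩

/-! ### Cauchy–Riemann equations of 𝑯 and φ compared -/

namespace OrientedSurface

variable {M : Type*} [TopologicalSpace M] [T2Space M]
  [ChartedSpace (EuclideanSpace ℝ (Fin 3)) M]
  [IsManifold (𝓡 3) ∞ M] [RiemannianBundle (fun x : M ↦ TangentSpace (𝓡 3) x)]
  [IsContMDiffRiemannianBundle (𝓡 3) ∞ (EuclideanSpace ℝ (Fin 3))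
    (fun x : M ↦ TangentSpace (𝓡 3) x)]
  {S : Type*} [TopologicalSpace S] [ChartedSpace (EuclideanSpace ℝ (Fin 2)) S]
  [IsManifold (𝓡 2) ∞ S] (Γ : OrientedSurface M S)
  {cov : CovariantDerivative (𝓡 3) (EuclideanSpace ℝ (Fin 3)) (TangentSpace (𝓡 3) : M → Type _)}
  [cov.ContMDiffCovariantDerivative ∞]
  {o : ManifoldOrientation M} {z : OpenPartialHomeomorph S ℂ}

/-- If `L = 0`, the complex mean curvature and the coefficient of the Hopf differential satisfy
the Cauchy–Riemann equations at the same points of a complex chart. -/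
lemma differentiableAt_complexMeanCurvature_iff (hcov : cov.IsMetricCompatible)
    (hL : ∀ (p : S) (u v : TangentSpace (𝓡 2) p), Γ.L cov o p u v = 0)
    (hz : IsComplexChart (Γ.J o) z) {ζ : ℂ} (hζ : ζ ∈ z.target) :
    DifferentiableAt ℂ (Γ.complexMeanCurvature cov o ∘ z.symm) ζ ↔
      DifferentiableAt ℂ (quadCoeff (Γ.II cov) z) ζ := by
  have hq := z.map_target hζ
  have hnear := z.open_target.mem_nhds hζ
  let h (v w : ℂ) : ℂ → ℝ := Γ.coeffII cov z v w ∘ z.symm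
  let l : ℂ → ℝ := Γ.conformalFactor z ∘ z.symm
  have hd (v w : ℂ) : DifferentiableAt ℝ (h v w) ζ :=
    hz.differentiableAt_comp_symm hζ (Γ.mdifferentiableAt_coeffII hcov hz hq v w)
  have hld : DifferentiableAt ℝ l ζ :=
    hz.differentiableAt_comp_symm hζ (Γ.mdifferentiableAt_conformalFactor hz hq)
  have hl : 0 < l ζ := Γ.conformalFactor_pos hz hq
  have e1 : Γ.complexMeanCurvature cov o ∘ z.symm =ᶠ[𝓝 ζ] fun ξ ↦
      (((h 1 1 + h Complex.I Complex.I) ξ : ℝ) +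
        Complex.I * ((h 1 Complex.I - h Complex.I 1) ξ : ℝ)) / (l ξ : ℂ) := by
    filter_upwards [hnear] with ξ hξ
    exact Γ.complexMeanCurvature_eq cov hz (z.map_target hξ)
  -- The coefficient of φ is put in the same form (a + i b) / l, with constant denominator 4, so
  -- that one criterion serves both functions.
  have e2 : quadCoeff (Γ.II cov) z =ᶠ[𝓝 ζ] fun ξ ↦
      (((h 1 1 - h Complex.I Complex.I) ξ : ℝ) +
        Complex.I * ((-(h 1 Complex.I + h Complex.I 1)) ξ : ℝ)) / ((4 : ℝ) : ℂ) := by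
    filter_upwards [hnear] with ξ hξ
    rw [quadCoeff_eq hz _ hξ, quadValue, Pi.neg_apply, Complex.ofReal_neg, mul_neg,
      ← sub_eq_add_neg, Complex.ofReal_ofNat]
    rfl
  rw [e1.differentiableAt_iff, e2.differentiableAt_iff,
    differentiableAt_div_iff ((hd _ _).add (hd _ _)) ((hd _ _).sub (hd _ _)) hld hl.ne',
    differentiableAt_div_iff ((hd _ _).sub (hd _ _)) ((hd _ _).add (hd _ _)).neg
      (differentiableAt_const _) (by norm_num)]
  obtain ⟨c1, c2⟩ := Γ.codazzi hcov hz hq (hL _)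
  simp only [← hz.fderiv_comp_symm hζ (Γ.mdifferentiableAt_coeffII hcov hz hq _ _),
    ← hz.fderiv_comp_symm hζ (Γ.mdifferentiableAt_conformalFactor hz hq)] at c1 c2
  change 2 * l ζ * (fderiv ℝ (h Complex.I 1) ζ 1 - fderiv ℝ (h 1 1) ζ Complex.I) =
    -fderiv ℝ l ζ 1 * (h 1 Complex.I ζ - h Complex.I 1 ζ) -
      fderiv ℝ l ζ Complex.I * (h 1 1 ζ + h Complex.I Complex.I ζ) at c1
  change 2 * l ζ * (fderiv ℝ (h Complex.I Complex.I) ζ 1 -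
      fderiv ℝ (h 1 Complex.I) ζ Complex.I) =
    fderiv ℝ l ζ 1 * (h 1 1 ζ + h Complex.I Complex.I ζ) -
      fderiv ℝ l ζ Complex.I * (h 1 Complex.I ζ - h Complex.I 1 ζ) at c2
  rw [fderiv_neg, fderiv_add (hd _ _) (hd _ _), fderiv_sub (hd _ _) (hd _ _),
    fderiv_add (hd _ _) (hd _ _), fderiv_sub (hd _ _) (hd _ _)]
  simp only [add_apply, sub_apply, neg_apply, Pi.add_apply, Pi.sub_apply, fderiv_fun_const,
    Pi.zero_apply, zero_apply, mul_zero, sub_zero, add_zero]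
  -- The Codazzi equations match the real parts of the two Cauchy–Riemann defects with equal sign
  -- (`c2`) and the imaginary parts with opposite sign (`c1`), up to the factor l; this is the
  -- complex conjugation in φ_z̄ = (l/4) · conj(𝑯_z̄). Positivity of l allows the division.
  constructor
  · rintro ⟨h1, h2⟩
    constructor <;> refine mul_left_cancel₀ hl.ne' ?_
    · linear_combination 4 * h1 - 4 * c2
    · linear_combination -4 * h2 - 4 * c1
  · rintro ⟨h1, h2⟩
    constructor
    · linear_combination l ζ * h1 / 4 + c2
    · linear_combination -l ζ * h2 / 4 - c1

lemma isHolomorphic_complexMeanCurvature_iff (hcov : cov.IsMetricCompatible)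
    (hL : ∀ (p : S) (u v : TangentSpace (𝓡 2) p), Γ.L cov o p u v = 0) :
    IsHolomorphic (Γ.J o) (Γ.complexMeanCurvature cov o) ↔
      IsHolomorphicQuadraticDifferential (Γ.J o) (quadCoeff (Γ.II cov)) := by
  constructor
  · refine fun h ↦ ⟨fun z w hz hw p hp ↦ quadCoeff_transform hz hw _ hp, fun z hz ζ hζ ↦ ?_⟩
    exact ((Γ.differentiableAt_complexMeanCurvature_iff hcov hL hz hζ).1
      ((h z hz).differentiableAt (z.open_target.mem_nhds hζ))).differentiableWithinAt
  · intro h z hz ζ hζ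
    exact ((Γ.differentiableAt_complexMeanCurvature_iff hcov hL hz hζ).2
      ((h.holomorphic z hz).differentiableAt
        (z.open_target.mem_nhds hζ))).differentiableWithinAt

end OrientedSurface

end RiemannCartan

end

theorem theoremB
    {M : Type*} [TopologicalSpace M] [T2Space M] [ChartedSpace (EuclideanSpace ℝ (Fin 3)) M]
    [IsManifold (𝓡 3) ∞ M]
    [RiemannianBundle (fun x : M ↦ TangentSpace (𝓡 3) x)]
    [IsContMDiffRiemannianBundle (𝓡 3) ∞ (EuclideanSpace ℝ (Fin 3))
      (fun x : M ↦ TangentSpace (𝓡 3) x)]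
    (o : RiemannCartan.ManifoldOrientation M)
    (cov : CovariantDerivative (𝓡 3) (EuclideanSpace ℝ (Fin 3)) (TangentSpace (𝓡 3) : M → Type _))
    [cov.ContMDiffCovariantDerivative ∞]
    (hcov : cov.IsMetricCompatible)
    {S : Type*} [TopologicalSpace S] [ChartedSpace (EuclideanSpace ℝ (Fin 2)) S]
    [IsManifold (𝓡 2) ∞ S]
    (Γ : RiemannCartan.OrientedSurface M S)
    (hL : ∀ (p : S) (u v : TangentSpace (𝓡 2) p), Γ.L cov o p u v = 0) :
    (RiemannCartan.IsHolomorphic (Γ.J o) (Γ.complexMeanCurvature cov o) ↔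
      RiemannCartan.IsHolomorphicQuadraticDifferential (Γ.J o)
        (RiemannCartan.quadCoeff (Γ.II cov))) ∧
    (RiemannCartan.IsHolomorphic (Γ.J o) (Γ.complexMeanCurvature cov o) →
      RiemannCartan.IsHolomorphicQuadraticDifferential (Γ.J o)
        (RiemannCartan.quadCoeff (Γ.III cov))) := by
  have key := Γ.isHolomorphic_complexMeanCurvature_iff hcov hL
  refine ⟨key, fun h ↦ ⟨fun z w hz hw p hp ↦
    RiemannCartan.quadCoeff_transform hz hw _ hp, fun z hz ↦ ?_⟩⟩
  -- By part (a) φ is holomorphic as well, and ψ = 𝑯 φ.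
  refine ((h z hz).mul ((key.1 h).holomorphic z hz)).congr fun ζ hζ ↦ ?_
  rw [RiemannCartan.quadCoeff_eq hz _ hζ, Γ.quadValue_III cov hz (z.map_target hζ), Pi.mul_apply,
    RiemannCartan.quadCoeff_eq hz _ hζ]
  rfl
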